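/- Let $A\in\mathbb{R}^{m\times n}$, $\lambda>0$, $q\in(0,1)$, and let $f:\mathbb{R}^m\to\mathbb{R}$ be twice continuously differentiable and bounded below, with $\nabla^2 f$ locally Lipschitz continuous on $\mathbb{R}^m$. Put $\psi(x)=f(Ax)$, $g(x)=\sum_{i=1}^n|x_i|^q$ and $F=\psi+\lambda g$ on $\mathbb{R}^n$. Assume that $F$ is a KL function of exponent $1/2$: for every $\bar x$ with $\partial F(\bar x)\neq\emptyset$ there are $c>0$, $\eta\in(0,\infty]$ and a neighbourhood $U$ of $\bar x$ such that $$\tfrac{c}{2}\,(F(x)-F(\bar x))^{-1/2}\,\mathrm{dist}(0,\partial F(x))\ge 1\quad\text{for all }x\in U\text{ with }F(\bar x)<F(x)<F(\bar x)+\eta,$$ where $\partial F$ is the limiting (Mordukhovich) subdifferential. Fix parameters $\tilde\tau>1$, $\tilde\alpha>0$, $\mu_{\max}>\mu_{\min}>0$, $\sigma\in(0,\frac12]$, $\varrho\in(0,\frac12)$, $\beta\in(0,1)$, $b_1>1$, $b_2>0$, and consider the following method (HpgSRN, with stopping tolerance $0$), started at any $x^0\in\mathbb{R}^n$. Here $|x|_{\min}$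 is the smallest absolute value of the nonzero entries of $x$; for $S\subseteq\{1,\dots,n\}$, $x_S$ is the subvector of $x$ with indices in $S$, $A_S$ consists of the columns of $A$ with indices in $S$, and $F_S(u)=f(A_Su)+\lambda\sum_{i\in S}|u_i|^q$ for $u\in\mathbb{R}^{|S|}$. For $k=0,1,2,\dots$: 1. (Proximal gradient step.) Choose $\mu_k\in[\mu_{\min},\mu_{\max}]$. For $l=0,1,\dots$ choose $$y^l\in\arg\min_{z\in\mathbb{R}^n}\Big\{\tfrac{\tilde\tau^l\mu_k}{2}\big\|z-\big(x^k-(\tilde\tau^l\mu_k)^{-1}\nabla\psi(x^k)\big)\big\|^2+\lambda g(z)\Big\}$$ until $F(y^l)\le F(x^k)-\frac{\tilde\alpha}{2}\|y^l-x^k\|^2$, and for this first such $l$ set $\bar x^k=y^l$, $\bar\mu_k=\tilde\tau^l\mu_k$. Stop if $\bar\mu_k\|x^k-\bar x^k\|_\infty\le 0$, that is, if $\bar x^k=x^k$. Otherwise, if $$\mathrm{sign}(x^k)=\mathrm{sign}(\bar x^k)\quad\text{and}\quad \bar\mu_k+\lambda q(q-1)|x^k|_{\min}^{q-2}\ge\tfrac12\big(\bar\mu_k+\lambda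 q(q-1)|\bar x^k|_{\min}^{q-2}\big)$$ (which forces $x^k,\bar x^k\ne0$), go to step 2; if this condition fails, put $x^{k+1}=\bar x^k$ and proceed to $k+1$. 2. (Subspace regularized Newton step.) Let $S_k=\mathrm{supp}(x^k)$, $u^k=x^k_{S_k}$, $r^k=\nabla F_{S_k}(u^k)$, $H^k=\nabla^2F_{S_k}(u^k)$, $\zeta_k=\max\{-\lambda_{\min}(H^k),0\}$. Let $d^k_{S_k}$ solve $\big(H^k+(b_1\zeta_k+b_2\|r^k\|^\sigma)I\big)d=-r^k$ and let the remaining entries of $d^k\in\mathbb{R}^n$ be $0$. Let $m_k$ be the smallest integer $m\ge0$ with $F_{S_k}(u^k+\beta^md^k_{S_k})\le F_{S_k}(u^k)+\varrho\beta^m\langle r^k,d^k_{S_k}\rangle$, put $x^{k+1}=x^k+\beta^{m_k}d^k$ and proceed to $k+1$. Suppose that the method does not stop, i.e. generates an infinite sequence $\{x^k\}_{k\in\mathbb{N}}$ (so $x^k\ne\bar x^k$ for all $k$). Then $\{F(x^k)\}$ converges $Q$-linearly to some value $F^*$: there are $F^*\in\mathbb{R}$, $\rho\in(0,1)$ and $K\in\mathbb{N}$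 such that $F(x^k)\to F^*$ and $|F(x^{k+1})-F^*|\le\rho\,|F(x^k)-F^*|$ for all $k\ge K$. -/

import Mathlib

open Set Filter Topology
open scoped Matrix InnerProductSpace ENNReal

noncomputable section

namespace HpgSRN

/-! Variational notions on a real Hilbert space -/

section Variational

variable {E : Type*} [NormedAddCommGroup E] [InnerProductSpace ℝ E]

/-- Regular (Fréchet) subdifferential of a real-valued function:
`v` belongs to it iff `h y ≥ h x + ⟪v, y - x⟫ + o(‖y - x‖)` as `y → x`. -/
def regularSubdiff (h : E → ℝ) (x : E) : Set E :=
  {v | ∀ ε > 0, ∀ᶠ y in 𝓝 x, h x + ⟪v, y - x⟫_ℝ - ε * ‖y - x‖ ≤ h y}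

/-- Limiting (Mordukhovich) subdifferential of a real-valued function. -/
def limitingSubdiff (h : E → ℝ) (x : E) : Set E :=
  {v | ∃ (y : ℕ → E) (w : ℕ → E),
    Tendsto y atTop (𝓝 x) ∧ Tendsto (fun j => h (y j)) atTop (𝓝 (h x)) ∧
    (∀ j, w j ∈ regularSubdiff h (y j)) ∧ Tendsto w atTop (𝓝 v)}

/-- The Kurdyka-Łojasiewicz inequality for `h` at `xbar` with desingularizing function `φ`, on a
neighbourhood of `xbar` and for function values in `(h xbar, h xbar + η)`. (A real `η > 0` is no
restriction compared with `η ∈ (0, ∞]`, since `η` may be decreased.) The distance of `0` to the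
subdifferential is `∞` if the latter is empty. -/
def KLInequality (h : E → ℝ) (φ : ℝ → ℝ) (xbar : E) : Prop :=
  ∃ η > 0, ∃ U ∈ 𝓝 xbar, ∀ x ∈ U, h xbar < h x → h x < h xbar + η →
    1 ≤ ENNReal.ofReal (deriv φ (h x - h xbar)) * Metric.infEDist 0 (limitingSubdiff h x)

/-- `h` has the KL property of exponent `1/2` at every point of the domain of its limiting
subdifferential: there the function `φ` can be chosen as `φ s = c * √s` with some `c > 0`. -/
def IsKLFunctionHalf (h : E → ℝ) : Prop :=
  ∀ xbar, (limitingSubdiff h xbar).Nonempty →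
    ∃ c > 0, KLInequality h (fun s => c * √s) xbar

/-- The proximal mapping of `h` with parameter `μ > 0`. -/
def prox (μ : ℝ) (h : E → ℝ) (x : E) : Set E :=
  {z | ∀ w, 1 / (2 * μ) * ‖z - x‖ ^ 2 + h z ≤ 1 / (2 * μ) * ‖w - x‖ ^ 2 + h w}

/-- The Hessian of `h` at `u`, as the derivative of the gradient mapping. -/
def hessian [CompleteSpace E] (h : E → ℝ) (u : E) : E →L[ℝ] E :=
  fderiv ℝ (gradient h) u

/-- The smallest eigenvalue of a symmetric operator on a nontrivial finite-dimensional space. -/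
def minEigenvalue (H : E →L[ℝ] E) : ℝ :=
  sInf {t : ℝ | Module.End.HasEigenvalue (H : E →ₗ[ℝ] E) t}

end Variational

/-! The objective function, on `ℝ^n` and on its coordinate subspaces -/

section Objective

variable {m : ℕ} {ι : Type*} [Fintype ι]

/-- `ψ(u) = f(B u)`. -/
def psi (f : EuclideanSpace ℝ (Fin m) → ℝ) (B : Matrix (Fin m) ι ℝ)
    (u : EuclideanSpace ℝ ι) : ℝ :=
  f (WithLp.toLp 2 (B *ᵥ u.ofLp))

/-- `‖u‖_q^q = ∑ |u_i|^q`. -/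
def lqPow (q : ℝ) (u : EuclideanSpace ℝ ι) : ℝ :=
  ∑ i, |u i| ^ q

/-- `f(B u) + lam * ‖u‖_q^q`. -/
def objective (f : EuclideanSpace ℝ (Fin m) → ℝ) (B : Matrix (Fin m) ι ℝ) (lam q : ℝ)
    (u : EuclideanSpace ℝ ι) : ℝ :=
  psi f B u + lam * lqPow q u

end Objective

section Subspace

variable {m n : ℕ}

/-- The support of `x`. -/
def supp (x : EuclideanSpace ℝ (Fin n)) : Finset (Fin n) :=
  Finset.univ.filter (fun i => x i ≠ 0)

/-- The smallest absolute value of the nonzero entries of `x` (for `x ≠ 0`). -/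
def absMin (x : EuclideanSpace ℝ (Fin n)) : ℝ :=
  ⨅ i : supp x, |x i|

/-- The subvector `x_S`. -/
def restrict (S : Finset (Fin n)) (x : EuclideanSpace ℝ (Fin n)) : EuclideanSpace ℝ S :=
  WithLp.toLp 2 (fun i => x i)

/-- The vector whose `S`-part is `d` and whose other entries are `0`. -/
def extend (S : Finset (Fin n)) (d : EuclideanSpace ℝ S) : EuclideanSpace ℝ (Fin n) :=
  WithLp.toLp 2 (fun i => if h : i ∈ S then d ⟨i, h⟩ else 0)

/-- `F_S(u) = f(A_S u) + lam * ∑_{i ∈ S} |u_i|^q`, where `A_S` has the columns of `A`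
with index in `S`. -/
def subObjective (f : EuclideanSpace ℝ (Fin m) → ℝ) (A : Matrix (Fin m) (Fin n) ℝ) (lam q : ℝ)
    (S : Finset (Fin n)) : EuclideanSpace ℝ S → ℝ :=
  objective f (A.submatrix id (fun i : S => (i : Fin n))) lam q

end Subspace

/-! The algorithm -/

/-- The parameters of the method. -/
structure Params where
  tau : ℝ
  alpha : ℝ
  muMin : ℝ
  muMax : ℝ
  sigma : ℝ
  rho : ℝ
  beta : ℝ
  b₁ : ℝ
  b₂ : ℝ
  eps : ℝ
  one_lt_tau : 1 < tau
  alpha_pos : 0 < alpha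
  muMin_pos : 0 < muMin
  muMin_lt_muMax : muMin < muMax
  sigma_pos : 0 < sigma
  sigma_le : sigma ≤ 1 / 2
  rho_pos : 0 < rho
  rho_lt : rho < 1 / 2
  beta_pos : 0 < beta
  beta_lt_one : beta < 1
  one_lt_b₁ : 1 < b₁
  b₂_pos : 0 < b₂
  eps_nonneg : 0 ≤ eps

section Algorithm

variable {m n : ℕ}

/-- `(xplus, muplus)` is a possible output of one proximal gradient step with backtracking
from `x` with initial step-size parameter `mu`: trial points `y 0, …, y l` are computed with
`mu, tau * mu, …, tau ^ l * mu`, and `y l` is the first one with sufficient decrease. -/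
def PGStep (f : EuclideanSpace ℝ (Fin m) → ℝ) (A : Matrix (Fin m) (Fin n) ℝ) (lam q : ℝ)
    (tau alpha : ℝ) (x : EuclideanSpace ℝ (Fin n)) (mu : ℝ)
    (xplus : EuclideanSpace ℝ (Fin n)) (muplus : ℝ) : Prop :=
  ∃ (l : ℕ) (y : ℕ → EuclideanSpace ℝ (Fin n)),
    (∀ j ≤ l, y j ∈ prox (tau ^ j * mu)⁻¹ (fun z => lam * lqPow q z)
      (x - (tau ^ j * mu)⁻¹ • gradient (psi f A) x)) ∧
    (∀ j < l, objective f A lam q x - alpha / 2 * ‖y j - x‖ ^ 2 < objective f A lam q (y j)) ∧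
    objective f A lam q (y l) ≤ objective f A lam q x - alpha / 2 * ‖y l - x‖ ^ 2 ∧
    xplus = y l ∧ muplus = tau ^ l * mu

/-- The stopping test `mubar * ‖x - xbar‖_∞ ≤ eps`. -/
def StopTest (eps : ℝ) (x xbar : EuclideanSpace ℝ (Fin n)) (mubar : ℝ) : Prop :=
  mubar * ‖(x - xbar).ofLp‖ ≤ eps

/-- The test for switching to the Newton step. If it holds for `x ≠ xbar`, then `x` and `xbar`
are both nonzero. -/
def SwitchTest (lam q : ℝ) (x xbar : EuclideanSpace ℝ (Fin n)) (mubar : ℝ) : Prop :=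
  (∀ i, SignType.sign (x i) = SignType.sign (xbar i)) ∧
  1 / 2 * (mubar + lam * q * (q - 1) * absMin xbar ^ (q - 2)) ≤
    mubar + lam * q * (q - 1) * absMin x ^ (q - 2)

/-- The regularized Hessian
`G = ∇²h(u) + (b₁ * [-λ_min(∇²h(u))]_+ + b₂ * ‖∇h(u)‖ ^ sigma) I`. -/
def regHessian {E : Type*} [NormedAddCommGroup E] [InnerProductSpace ℝ E] [CompleteSpace E]
    (b₁ b₂ sigma : ℝ) (h : E → ℝ) (u : E) : E →L[ℝ] E :=
  hessian h u +
    (b₁ * max (-minEigenvalue (hessian h u)) 0 + b₂ * ‖gradient h u‖ ^ sigma) •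
      ContinuousLinearMap.id ℝ E

/-- `xplus` is obtained from `x` by the subspace regularized Newton step with Armijo
line search on the support `S` of `x`. -/
def NewtonStep (f : EuclideanSpace ℝ (Fin m) → ℝ) (A : Matrix (Fin m) (Fin n) ℝ) (lam q : ℝ)
    (P : Params) (x xplus : EuclideanSpace ℝ (Fin n)) : Prop :=
  let S := supp x
  let u := restrict S x
  let FS := subObjective f A lam q S
  ∃ (d : EuclideanSpace ℝ S) (j : ℕ),
    regHessian P.b₁ P.b₂ P.sigma FS u d = -gradient FS u ∧
    IsLeast {i : ℕ | FS (u + P.beta ^ i • d) ≤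
      FS u + P.rho * P.beta ^ i * ⟪gradient FS u, d⟫_ℝ} j ∧
    xplus = x + P.beta ^ j • extend S d

/-- `x 0, x 1, …` is an infinite sequence of iterates of the method, with proximal
points `xbar k`, initial step-size parameters `mu k` and accepted ones `mubar k`. -/
structure IsInfiniteRun (f : EuclideanSpace ℝ (Fin m) → ℝ) (A : Matrix (Fin m) (Fin n) ℝ)
    (lam q : ℝ) (P : Params) (x xbar : ℕ → EuclideanSpace ℝ (Fin n)) (mu mubar : ℕ → ℝ) :
    Prop where
  mu_mem : ∀ k, mu k ∈ Icc P.muMin P.muMax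
  pgStep : ∀ k, PGStep f A lam q P.tau P.alpha (x k) (mu k) (xbar k) (mubar k)
  not_stop : ∀ k, ¬ StopTest P.eps (x k) (xbar k) (mubar k)
  step_pg : ∀ k, ¬ SwitchTest lam q (x k) (xbar k) (mubar k) → x (k + 1) = xbar k
  step_newton : ∀ k, SwitchTest lam q (x k) (xbar k) (mubar k) →
    NewtonStep f A lam q P (x k) (x (k + 1))

end Algorithm

/-- The real sequence `a` converges to `L` at a `Q`-linear rate. -/
def ConvergesQLinearly (a : ℕ → ℝ) (L : ℝ) : Prop :=
  Tendsto a atTop (𝓝 L) ∧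
    ∃ r : ℝ, 0 < r ∧ r < 1 ∧ ∃ K : ℕ, ∀ k ≥ K, |a (k + 1) - L| ≤ r * |a k - L|

end HpgSRN

end

/-!
Write `F` for the objective and `critVec x` for the gradient of `F` along the support of `x`,
extended by zero. This vector is a regular subgradient of `F` at `x` (`critVec_mem_regularSubdiff`):
at a zero entry, `|·| ^ q` with `q < 1` admits every slope.

Each iteration with iterates `x`, `x⁺` satisfies one of
`‖critVec x⁺‖² ≤ C (F x - F x⁺)` and `‖critVec x‖² ≤ C (F x - F x⁺)`, with `C` independent of the
iteration (`exists_step_decrease`). As `F` is coercive and decreasing along the run, the iterates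
are bounded, and the KL inequality of exponent `1 / 2` holds along them with one constant `C'`
(`IsKLFunctionHalf.exists_uniform`). Hence, with `Δ = F x - F*`, both cases give
`Δ⁺ ≤ C' C (Δ - Δ⁺)`, which is a linear rate (`convergesQLinearly_of_sub_le`).

In a proximal gradient step the first estimate follows from the stationarity of the proximal point
(`norm_critVec_prox_le`), the sufficient decrease enforced by the backtracking, and the boundedness
of the accepted parameters (`exists_stepsize_le`).

In a Newton step the second estimate holds because the Armijo step lengths are bounded away from
zero (`newtonStep_decrease_of_bounds`). This needs a Lipschitz Hessian on a neighbourhood of fixed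
size, so the nonzero entries of the iterate must stay away from zero: those of a proximal
point do (`prox_entry_bound`), and the switching test transfers the bound to the current iterate
(`le_abs_of_switchTest`).
-/

namespace HpgSRN

/-! ### Gradient, Hessian, and smallest eigenvalue -/

section Hessian

variable {V : Type*} [NormedAddCommGroup V] [InnerProductSpace ℝ V] [CompleteSpace V]

lemma gradient_eq_comp_fderiv (h : V → ℝ) :
    gradient h = fun y => (InnerProductSpace.toDual ℝ V).symm (fderiv ℝ h y) := rfl

lemma contDiffAt_gradient {h : V → ℝ} {u : V} {k : ℕ} (hh : ContDiffAt ℝ (k + 1 : ℕ) h u) :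
    ContDiffAt ℝ k (gradient h) u := by
  rw [gradient_eq_comp_fderiv]
  exact (InnerProductSpace.toDual ℝ V).symm.toContinuousLinearEquiv.contDiff.contDiffAt.comp u
    (hh.fderiv_right (m := k) (by simp))

lemma hasFDerivAt_gradient {h : V → ℝ} {u : V} (hh : ContDiffAt ℝ 2 h u) :
    HasFDerivAt (gradient h) (hessian h u) u :=
  ((contDiffAt_gradient (k := 1) (by simpa using hh)).differentiableAt
    (by simp)).hasFDerivAt

lemma contDiffAt_hessian {h : V → ℝ} {u : V} (hh : ContDiffAt ℝ 3 h u) :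
    ContDiffAt ℝ 1 (hessian h) u :=
  (contDiffAt_gradient (k := 2) (by simpa using hh)).fderiv_right (m := 1)
    (by norm_num)

lemma inner_hessian_comm {h : V → ℝ} {u : V} (hh : ContDiffAt ℝ 2 h u) (v w : V) :
    ⟪hessian h u v, w⟫_ℝ = ⟪v, hessian h u w⟫_ℝ := by
  have key : ∀ a b, ⟪hessian h u a, b⟫_ℝ = fderiv ℝ (fderiv ℝ h) u a b := by
    intro a b
    have hd : DifferentiableAt ℝ (fderiv ℝ h) u :=
      (hh.fderiv_right (m := 1) (by norm_num)).differentiableAt (by simp)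
    have e1 : HasFDerivAt (fun y => fderiv ℝ h y b) ((fderiv ℝ (fderiv ℝ h) u).flip b) u := by
      simpa using hd.hasFDerivAt.clm_apply (hasFDerivAt_const b u)
    have e2 := (hasFDerivAt_gradient hh).inner ℝ (hasFDerivAt_const b u)
    simp only [inner_gradient_left] at e2
    simpa using (DFunLike.congr_fun (e1.unique e2) a).symm
  have hs : IsSymmSndFDerivAt ℝ h u := hh.isSymmSndFDerivAt (by simp)
  rw [real_inner_comm _ v, key, key]
  exact hs.eq v w

/-- Second-order Taylor estimate with cubic remainder; the constant `L` is not the sharp `L / 6`. -/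
lemma taylor_two_le {h : V → ℝ} {u w : V} {δ L : ℝ} (hL : 0 ≤ L)
    (hh : ∀ y ∈ Metric.closedBall u δ, ContDiffAt ℝ 2 h y)
    (hLip : ∀ y ∈ Metric.closedBall u δ, ‖hessian h y - hessian h u‖ ≤ L * ‖y - u‖)
    (hw : ‖w‖ ≤ δ) :
    h (u + w) ≤ h u + ⟪gradient h u, w⟫_ℝ + 1 / 2 * ⟪hessian h u w, w⟫_ℝ + L * ‖w‖ ^ 3 := by
  have hsub : Metric.closedBall u ‖w‖ ⊆ Metric.closedBall u δ :=
    Metric.closedBall_subset_closedBall hw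
  have hconv : Convex ℝ (Metric.closedBall u ‖w‖) := convex_closedBall u _
  have hu : u ∈ Metric.closedBall u ‖w‖ := Metric.mem_closedBall_self (norm_nonneg w)
  have huw : u + w ∈ Metric.closedBall u ‖w‖ := by simp
  have hn : ∀ y ∈ Metric.closedBall u ‖w‖, ‖y - u‖ ≤ ‖w‖ := fun y hy => by
    simpa [dist_eq_norm] using hy
  have h1 : ∀ y ∈ Metric.closedBall u ‖w‖,
      ‖gradient h y - gradient h u - hessian h u (y - u)‖ ≤ L * ‖w‖ ^ 2 := by
    intro y hy
    have := hconv.norm_image_sub_le_of_norm_hasFDerivWithin_le' (f := gradient h)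
      (f' := hessian h) (φ := hessian h u) (C := L * ‖w‖)
      (fun z hz => (hasFDerivAt_gradient (hh z (hsub hz))).hasFDerivWithinAt)
      (fun z hz => (hLip z (hsub hz)).trans (mul_le_mul_of_nonneg_left (hn z hz) hL)) hu hy
    refine this.trans ?_
    rw [pow_two, ← mul_assoc]
    exact mul_le_mul_of_nonneg_left (hn y hy) (by positivity)
  set H := hessian h u with hH
  have hq : ∀ y : V, HasFDerivAt (fun y => (1 / 2 : ℝ) * ⟪H (y - u), y - u⟫_ℝ)
      (innerSL ℝ (H (y - u))) y := by
    intro y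
    have e1 : HasFDerivAt (fun y => y - u) (ContinuousLinearMap.id ℝ V) y :=
      (hasFDerivAt_id y).sub_const u
    have e2 : HasFDerivAt (fun y => H (y - u)) H y := by
      exact H.hasFDerivAt.comp y e1
    refine ((e2.inner ℝ e1).const_mul (1 / 2 : ℝ)).congr_fderiv ?_
    ext v
    have : ⟪H v, y - u⟫_ℝ = ⟪H (y - u), v⟫_ℝ := by
      rw [hH, inner_hessian_comm (hh u (hsub hu)), real_inner_comm]
    simp only [smul_apply, fderivInnerCLM_apply, ContinuousLinearMap.comp_apply,
      ContinuousLinearMap.prod_apply, ContinuousLinearMap.id_apply, innerSL_apply_apply, smul_eq_mul,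
      this]
    ring
  have h2 := hconv.norm_image_sub_le_of_norm_hasFDerivWithin_le'
    (f := fun y => h y - 1 / 2 * ⟪H (y - u), y - u⟫_ℝ)
    (f' := fun y => fderiv ℝ h y - innerSL ℝ (H (y - u))) (φ := innerSL ℝ (gradient h u))
    (C := L * ‖w‖ ^ 2)
    (fun z hz => ((((hh z (hsub hz)).differentiableAt (by simp)).hasFDerivAt).sub
      (hq z)).hasFDerivWithinAt)
    (fun z hz => by
      have e : fderiv ℝ h z - innerSL ℝ (H (z - u)) - innerSL ℝ (gradient h u)
          = innerSL ℝ (gradient h z - gradient h u - H (z - u)) := by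
        ext v
        simp [inner_gradient_left]
        ring
      rw [e, innerSL_apply_norm]
      exact h1 z hz) hu huw
  simp only [add_sub_cancel_left, sub_self, map_zero, inner_zero_left, mul_zero, sub_zero,
    innerSL_apply_apply] at h2
  have := (abs_le.1 h2).2
  have e : L * ‖w‖ ^ 2 * ‖w‖ = L * ‖w‖ ^ 3 := by ring
  linarith

omit [CompleteSpace V] in
lemma minEigenvalue_mul_le [FiniteDimensional ℝ V] [Nontrivial V] {H : V →L[ℝ] V}
    (hH : ∀ v w, ⟪H v, w⟫_ℝ = ⟪v, H w⟫_ℝ) (w : V) :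
    minEigenvalue H * ‖w‖ ^ 2 ≤ ⟪H w, w⟫_ℝ := by
  have hsym : (H : V →ₗ[ℝ] V).IsSymmetric := hH
  have hfin : {t : ℝ | Module.End.HasEigenvalue (H : V →ₗ[ℝ] V) t}.Finite :=
    Module.End.finite_hasEigenvalue _
  have h1 := csInf_le hfin.bddBelow hsym.hasEigenvalue_iInf_of_finiteDimensional
  rcases eq_or_ne w 0 with rfl | hw
  · simp
  have hpos : 0 < ‖w‖ ^ 2 := by positivity
  have hb : BddBelow (range fun v : {v : V // v ≠ 0} =>
      RCLike.re ⟪(H : V →ₗ[ℝ] V) v, (v : V)⟫_ℝ / ‖(v : V)‖ ^ 2) := by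
    refine ⟨-‖H‖, ?_⟩
    rintro _ ⟨v, rfl⟩
    have := (abs_le.1 (H.rayleighQuotient_le_norm (v : V))).1
    simpa [ContinuousLinearMap.rayleighQuotient, ContinuousLinearMap.reApplyInnerSelf] using this
  have h2 := ciInf_le hb ⟨w, hw⟩
  have h3 : minEigenvalue H ≤ ⟪H w, w⟫_ℝ / ‖w‖ ^ 2 := by
    refine h1.trans ?_
    simpa using h2
  rwa [le_div_iff₀ hpos] at h3

omit [CompleteSpace V] in
lemma neg_norm_le_minEigenvalue [FiniteDimensional ℝ V] [Nontrivial V] {H : V →L[ℝ] V}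
    (hH : ∀ v w, ⟪H v, w⟫_ℝ = ⟪v, H w⟫_ℝ) : -‖H‖ ≤ minEigenvalue H := by
  have hsym : (H : V →ₗ[ℝ] V).IsSymmetric := hH
  refine le_csInf ⟨_, hsym.hasEigenvalue_iInf_of_finiteDimensional⟩ fun t ht => ?_
  obtain ⟨v, hv⟩ := ht.exists_hasEigenvector
  have hv0 : 0 < ‖v‖ := norm_pos_iff.2 hv.2
  have e : H v = t • v := hv.apply_eq_smul
  have : |t| * ‖v‖ ≤ ‖H‖ * ‖v‖ := by
    rw [← Real.norm_eq_abs, ← norm_smul, ← e]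
    exact H.le_opNorm v
  exact (abs_le.1 (le_of_mul_le_mul_right this hv0)).1

end Hessian

/-! ### Sufficient decrease of a regularized Newton step -/

section Newton

variable {V : Type*} [NormedAddCommGroup V] [InnerProductSpace ℝ V]

lemma norm_sq_apply_le_mul_inner {G : V →L[ℝ] V} {M : ℝ} (hM : 0 < M) (hG : ‖G‖ ≤ M)
    (hsym : ∀ v w, ⟪G v, w⟫_ℝ = ⟪v, G w⟫_ℝ) (hpos : ∀ w, 0 ≤ ⟪G w, w⟫_ℝ) (d : V) :
    ‖G d‖ ^ 2 ≤ M * ⟪G d, d⟫_ℝ := by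
  -- The estimate is the positivity of the form at `M • d - G d`.
  have h1 := hpos (M • d - G d)
  have h2 : ⟪G (G d), G d⟫_ℝ ≤ M * ‖G d‖ ^ 2 := by
    calc ⟪G (G d), G d⟫_ℝ ≤ ‖G (G d)‖ * ‖G d‖ := real_inner_le_norm _ _
      _ ≤ (M * ‖G d‖) * ‖G d‖ := by
        gcongr
        exact (G.le_opNorm _).trans (by gcongr)
      _ = M * ‖G d‖ ^ 2 := by ring
  have h3 : ⟪G (G d), d⟫_ℝ = ‖G d‖ ^ 2 := by rw [hsym, real_inner_self_eq_norm_sq]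
  have h4 : ⟪G d, G d⟫_ℝ = ‖G d‖ ^ 2 := real_inner_self_eq_norm_sq _
  simp only [map_sub, map_smul, inner_sub_left, inner_sub_right, real_inner_smul_left,
    real_inner_smul_right, h3, h4] at h1
  have h5 : 0 ≤ M * (M * ⟪G d, d⟫_ℝ - ‖G d‖ ^ 2) := by nlinarith
  have := nonneg_of_mul_nonneg_right h5 hM
  linarith

variable [FiniteDimensional ℝ V]

/-- The Armijo step lengths of the regularized Newton direction stay away from zero.  In the cubic
Taylor estimate at step length `t`, the quadratic term takes at most half of the slope
`⟪∇h u, d⟫ = -⟪G d, d⟫`, and the cubic term `L t³ ‖d‖³` is absorbed because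
`‖d‖ ≤ ‖∇h u‖ ^ (1 - σ) / b₂` while `⟪G d, d⟫ ≥ b₂ ‖∇h u‖ ^ σ ‖d‖²`; since `σ ≤ 1 / 2`, the required
bound on `t` does not degenerate as `∇h u → 0`. -/
lemma newtonStep_decrease_of_bounds {P : Params} {δ L M R : ℝ} (hδ : 0 < δ) (hL : 0 ≤ L)
    (hM : 0 ≤ M) (hR : 0 < R) :
    ∃ c > 0, ∀ (h : V → ℝ) (u d : V) (j : ℕ),
      (∀ y ∈ Metric.closedBall u δ, ContDiffAt ℝ 2 h y) →
      (∀ y ∈ Metric.closedBall u δ, ‖hessian h y - hessian h u‖ ≤ L * ‖y - u‖) →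
      ‖hessian h u‖ ≤ M → ‖gradient h u‖ ≤ R →
      regHessian P.b₁ P.b₂ P.sigma h u d = -gradient h u →
      IsLeast {i : ℕ | h (u + P.beta ^ i • d) ≤
        h u + P.rho * P.beta ^ i * ⟪gradient h u, d⟫_ℝ} j →
      c * ‖gradient h u‖ ^ 2 ≤ h u - h (u + P.beta ^ j • d) := by
  have hb₁ : 0 < P.b₁ := zero_lt_one.trans P.one_lt_b₁
  have hb₂ := P.b₂_pos
  have hβ := P.beta_pos
  have hρ := P.rho_pos
  have hρ' := P.rho_lt
  have hσ := P.sigma_pos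
  have hσ' := P.sigma_le
  set Mg := M + (P.b₁ * M + P.b₂ * R ^ P.sigma) with hMg
  have hMg0 : 0 < Mg := by positivity
  -- Below `t₀`, the step stays in the `δ`-ball and the cubic Taylor term is absorbed.
  obtain ⟨t₀, ht₀, ht₁, ht₂, ht₃⟩ : ∃ t₀ > 0, t₀ ≤ 1 ∧ t₀ * (R ^ (1 - P.sigma) / P.b₂) ≤ δ ∧
      t₀ * (L * R ^ (1 - 2 * P.sigma)) ≤ (1 / 2 - P.rho) * P.b₂ ^ 2 := by
    have hD : 0 < R ^ (1 - P.sigma) / P.b₂ := by positivity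
    have hE : 0 < L * R ^ (1 - 2 * P.sigma) + 1 := by positivity
    have hF : 0 < (1 / 2 - P.rho) * P.b₂ ^ 2 := mul_pos (by linarith) (by positivity)
    refine ⟨min 1 (min (δ / (R ^ (1 - P.sigma) / P.b₂))
      ((1 / 2 - P.rho) * P.b₂ ^ 2 / (L * R ^ (1 - 2 * P.sigma) + 1))), by positivity,
      min_le_left _ _, ?_, ?_⟩
    · rw [← le_div_iff₀ hD]
      exact (min_le_right _ _).trans (min_le_left _ _)
    · refine (mul_le_mul_of_nonneg_left (lt_add_one _).le (by positivity)).trans ?_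
      rw [← le_div_iff₀ hE]
      exact (min_le_right _ _).trans (min_le_right _ _)
  refine ⟨P.rho * (P.beta * t₀) / Mg, by positivity, ?_⟩
  intro h u d j hC2 hLip hHM hrR hGd hj
  set r := gradient h u with hr
  set H := hessian h u with hH
  -- If the gradient vanishes, the regularized Hessian may be singular and `d` need not be zero, but
  -- the Armijo condition still excludes an increase.
  rcases eq_or_ne r 0 with hr0 | hr0
  · have := hj.1
    simp only [mem_ofPred_eq, hr0, inner_zero_left, mul_zero, add_zero] at this
    simp [hr0, this]
  have hrpos : 0 < ‖r‖ := norm_pos_iff.2 hr0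
  have : Nontrivial V := ⟨r, 0, hr0⟩
  have hu : u ∈ Metric.closedBall u δ := Metric.mem_closedBall_self hδ.le
  have hHsym : ∀ v w, ⟪H v, w⟫_ℝ = ⟪v, H w⟫_ℝ := inner_hessian_comm (hC2 u hu)
  set G := regHessian P.b₁ P.b₂ P.sigma h u with hG
  set s := P.b₁ * max (-minEigenvalue H) 0 + P.b₂ * ‖r‖ ^ P.sigma with hs
  have hGapp : ∀ w, G w = H w + s • w := fun w => by simp [hG, regHessian, hs, hH, hr]
  have hs0 : 0 ≤ s := by positivity
  have hHG : ∀ w, ⟪G w, w⟫_ℝ = ⟪H w, w⟫_ℝ + s * ‖w‖ ^ 2 := fun w => by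
    rw [hGapp, inner_add_left, real_inner_smul_left, real_inner_self_eq_norm_sq]
  have hGlow : ∀ w, P.b₂ * ‖r‖ ^ P.sigma * ‖w‖ ^ 2 ≤ ⟪G w, w⟫_ℝ := by
    intro w
    rw [hHG]
    have h1 := minEigenvalue_mul_le hHsym w
    have h2 : 0 ≤ minEigenvalue H + P.b₁ * max (-minEigenvalue H) 0 := by
      have h3 : max (-minEigenvalue H) 0 ≤ P.b₁ * max (-minEigenvalue H) 0 :=
        le_mul_of_one_le_left (le_max_right _ _) P.one_lt_b₁.le
      have := le_max_left (-minEigenvalue H) 0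
      linarith
    have h4 := mul_nonneg h2 (sq_nonneg ‖w‖)
    rw [hs]
    linarith
  have hGsym : ∀ v w, ⟪G v, w⟫_ℝ = ⟪v, G w⟫_ℝ := fun v w => by
    simp [hGapp, inner_add_left, inner_add_right, hHsym, real_inner_smul_left,
      real_inner_smul_right]
  have hGM : ‖G‖ ≤ Mg := by
    refine G.opNorm_le_bound hMg0.le fun w => ?_
    rw [hGapp]
    have hsle : s ≤ P.b₁ * M + P.b₂ * R ^ P.sigma := by
      have h1 := neg_norm_le_minEigenvalue hHsym
      have h2 : max (-minEigenvalue H) 0 ≤ M := max_le (by linarith) hM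
      have h3 : ‖r‖ ^ P.sigma ≤ R ^ P.sigma := Real.rpow_le_rpow hrpos.le hrR hσ.le
      rw [hs]
      gcongr
    calc ‖H w + s • w‖ ≤ ‖H w‖ + ‖s • w‖ := norm_add_le _ _
      _ ≤ M * ‖w‖ + s * ‖w‖ := by
        rw [norm_smul, Real.norm_of_nonneg hs0]
        gcongr
        exact (H.le_opNorm w).trans (by gcongr)
      _ ≤ Mg * ‖w‖ := by
        rw [← add_mul]
        refine mul_le_mul_of_nonneg_right ?_ (norm_nonneg w)
        linarith
  have hGpos : ∀ w, 0 ≤ ⟪G w, w⟫_ℝ := fun w => le_trans (by positivity) (hGlow w)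
  set g := ⟪G d, d⟫_ℝ with hg
  have hrd : ⟪r, d⟫_ℝ = -g := by rw [hg, hGd, inner_neg_left, neg_neg]
  have hg0 : 0 ≤ g := hGpos d
  have hrg : ‖r‖ ^ 2 ≤ Mg * g := by
    have := norm_sq_apply_le_mul_inner hMg0 hGM hGsym hGpos d
    rwa [← hg, hGd, norm_neg] at this
  have hd : ‖d‖ ≤ ‖r‖ ^ (1 - P.sigma) / P.b₂ := by
    rcases eq_or_ne d 0 with rfl | hd0
    · simp only [norm_zero]
      positivity
    have hdpos : 0 < ‖d‖ := norm_pos_iff.2 hd0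
    have h1 : P.b₂ * ‖r‖ ^ P.sigma * ‖d‖ ^ 2 ≤ ‖r‖ * ‖d‖ := by
      refine (hGlow d).trans ((real_inner_le_norm _ _).trans ?_)
      rw [hGd, norm_neg]
    have h2 : P.b₂ * ‖r‖ ^ P.sigma * ‖d‖ ≤ ‖r‖ := by
      refine le_of_mul_le_mul_right ?_ hdpos
      linarith [h1]
    rw [le_div_iff₀ hb₂, Real.rpow_sub hrpos, Real.rpow_one, le_div_iff₀ (by positivity)]
    linarith
  have harm : ∀ t : ℝ, 0 < t → t ≤ t₀ → h (u + t • d) ≤ h u + P.rho * t * ⟪r, d⟫_ℝ := by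
    intro t ht htt
    have ht1 : t ≤ 1 := htt.trans ht₁
    have htd : ‖t • d‖ ≤ δ := by
      rw [norm_smul, Real.norm_of_nonneg ht.le]
      refine le_trans ?_ ht₂
      have : ‖r‖ ^ (1 - P.sigma) ≤ R ^ (1 - P.sigma) :=
        Real.rpow_le_rpow hrpos.le hrR (by linarith)
      refine mul_le_mul htt (hd.trans ?_) (norm_nonneg _) ht₀.le
      gcongr
    have hT := taylor_two_le hL hC2 hLip htd
    have hcub : L * t ^ 2 * ‖d‖ ^ 3 ≤ (1 / 2 - P.rho) * g := by
      -- This is where `σ ≤ 1 / 2` enters: the exponent `1 - 2 σ` is nonnegative.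
      have e1 : ‖r‖ ^ (1 - P.sigma) = ‖r‖ ^ P.sigma * ‖r‖ ^ (1 - 2 * P.sigma) := by
        rw [← Real.rpow_add hrpos]
        congr 1
        ring
      have e2 : ‖r‖ ^ (1 - 2 * P.sigma) ≤ R ^ (1 - 2 * P.sigma) :=
        Real.rpow_le_rpow hrpos.le hrR (by linarith)
      have e3 : t ^ 2 ≤ t₀ := by nlinarith
      calc L * t ^ 2 * ‖d‖ ^ 3 = L * t ^ 2 * ‖d‖ ^ 2 * ‖d‖ := by ring
        _ ≤ L * t₀ * ‖d‖ ^ 2 * (‖r‖ ^ P.sigma * R ^ (1 - 2 * P.sigma) / P.b₂) := by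
          gcongr
          refine hd.trans ?_
          rw [e1]
          gcongr
        _ = t₀ * (L * R ^ (1 - 2 * P.sigma)) * (‖d‖ ^ 2 * ‖r‖ ^ P.sigma / P.b₂) := by ring
        _ ≤ (1 / 2 - P.rho) * P.b₂ ^ 2 * (‖d‖ ^ 2 * ‖r‖ ^ P.sigma / P.b₂) := by
          gcongr
        _ = (1 / 2 - P.rho) * (P.b₂ * ‖r‖ ^ P.sigma * ‖d‖ ^ 2) := by
          field_simp
        _ ≤ (1 / 2 - P.rho) * g := by
          have : 0 ≤ 1 / 2 - P.rho := by linarith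
          gcongr
          exact hGlow d
    have hquad : ⟪H d, d⟫_ℝ ≤ g := by
      have := hHG d
      have h2 : 0 ≤ s * ‖d‖ ^ 2 := by positivity
      linarith
    rw [real_inner_smul_right, map_smul, real_inner_smul_left, real_inner_smul_right, norm_smul,
      Real.norm_of_nonneg ht.le] at hT
    change h (u + t • d) ≤ h u + t * ⟪r, d⟫_ℝ + 1 / 2 * (t * (t * ⟪H d, d⟫_ℝ)) +
      L * (t * ‖d‖) ^ 3 at hT
    rw [hrd] at hT ⊢
    have h1 : t * (t * ⟪H d, d⟫_ℝ) ≤ t * g := by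
      have : t * ⟪H d, d⟫_ℝ ≤ 1 * g := by
        rcases le_total 0 ⟪H d, d⟫_ℝ with h0 | h0
        · exact mul_le_mul ht1 hquad h0 zero_le_one
        · exact (mul_nonpos_of_nonneg_of_nonpos ht.le h0).trans (by linarith)
      rw [one_mul] at this
      gcongr
    have h2 : t * (L * t ^ 2 * ‖d‖ ^ 3) ≤ t * ((1 / 2 - P.rho) * g) := by gcongr
    have e : L * (t * ‖d‖) ^ 3 = t * (L * t ^ 2 * ‖d‖ ^ 3) := by ring
    rw [e] at hT
    linarith
  have hstep : P.beta * t₀ ≤ P.beta ^ j := by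
    rcases Nat.eq_zero_or_pos j with rfl | hjpos
    · rw [pow_zero]
      exact mul_le_one₀ P.beta_lt_one.le ht₀.le ht₁
    -- The last rejected step length exceeds `t₀`.
    · obtain ⟨i, rfl⟩ := Nat.exists_eq_succ_of_ne_zero hjpos.ne'
      have : t₀ < P.beta ^ i := by
        by_contra hcon
        have := hj.2 (harm _ (pow_pos hβ i) (not_lt.1 hcon))
        omega
      rw [Nat.succ_eq_add_one, pow_succ']
      gcongr
  have hdec := hj.1
  simp only [mem_ofPred_eq, hrd] at hdec
  have h1 : P.rho * (P.beta * t₀) * g ≤ P.rho * P.beta ^ j * g := by gcongr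
  have h2 : P.rho * (P.beta * t₀) / Mg * ‖r‖ ^ 2 ≤ P.rho * (P.beta * t₀) * g := by
    rw [div_mul_eq_mul_div, div_le_iff₀ hMg0, mul_assoc _ g, mul_comm g]
    gcongr
  linarith

/-- On a compact set inside an open set of regularity, compactness supplies the bounds required by
`newtonStep_decrease_of_bounds`. -/
lemma exists_newtonStep_decrease (P : Params) {h : V → ℝ} {D K : Set V} (hD : IsOpen D)
    (hK : IsCompact K) (hKD : K ⊆ D) (hC2 : ∀ y ∈ D, ContDiffAt ℝ 2 h y)
    (hLip : LocallyLipschitzOn D (hessian h)) :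
    ∃ c > 0, ∀ u ∈ K, ∀ (d : V) (j : ℕ),
      regHessian P.b₁ P.b₂ P.sigma h u d = -gradient h u →
      IsLeast {i : ℕ | h (u + P.beta ^ i • d) ≤
        h u + P.rho * P.beta ^ i * ⟪gradient h u, d⟫_ℝ} j →
      c * ‖gradient h u‖ ^ 2 ≤ h u - h (u + P.beta ^ j • d) := by
  obtain ⟨δ, hδ, hδD⟩ := hK.exists_cthickening_subset_open hD hKD
  obtain ⟨L, hL⟩ := (hLip.mono hδD).exists_lipschitzOnWith_of_compact hK.cthickening
  obtain ⟨M, hM⟩ := hK.exists_bound_of_continuousOn (hLip.continuousOn.mono hKD)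
  obtain ⟨R, hR⟩ := hK.exists_bound_of_continuousOn (f := gradient h) fun y hy =>
    (hasFDerivAt_gradient (hC2 y (hKD hy))).continuousAt.continuousWithinAt
  obtain ⟨c, hc, H⟩ := newtonStep_decrease_of_bounds (V := V) (P := P) hδ L.coe_nonneg
    (abs_nonneg M) (by positivity : 0 < |R| + 1)
  refine ⟨c, hc, fun u hu d j => H h u d j ?_ ?_ ?_ ?_⟩
  · exact fun y hy => hC2 y (hδD (Metric.closedBall_subset_cthickening hu δ hy))
  · intro y hy
    have := hL.dist_le_mul y (Metric.closedBall_subset_cthickening hu δ hy) u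
      (Metric.closedBall_subset_cthickening hu δ (Metric.mem_closedBall_self hδ.le))
    simpa [dist_eq_norm] using this
  · exact (hM u hu).trans (le_abs_self M)
  · exact (hR u hu).trans ((le_abs_self R).trans (by linarith))

end Newton

/-! ### The smooth part and the power function -/

section Psi

variable {m : ℕ} {ι : Type*} [Fintype ι] {f : EuclideanSpace ℝ (Fin m) → ℝ}

/-- The matrix `B` as a continuous linear map between Euclidean spaces. -/
noncomputable def matCLM (B : Matrix (Fin m) ι ℝ) :
    EuclideanSpace ℝ ι →L[ℝ] EuclideanSpace ℝ (Fin m) :=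
  LinearMap.toContinuousLinearMap
    { toFun := fun u => WithLp.toLp 2 (B *ᵥ u.ofLp)
      map_add' := fun u v => by simp [Matrix.mulVec_add]
      map_smul' := fun c u => by simp [Matrix.mulVec_smul] }

lemma psi_eq_comp (B : Matrix (Fin m) ι ℝ) : psi f B = fun u => f (matCLM B u) := rfl

lemma contDiff_psi (hf : ContDiff ℝ 2 f) (B : Matrix (Fin m) ι ℝ) : ContDiff ℝ 2 (psi f B) :=
  hf.comp (matCLM B).contDiff

lemma gradient_psi (hf : ContDiff ℝ 2 f) (B : Matrix (Fin m) ι ℝ) (u : EuclideanSpace ℝ ι) :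
    gradient (psi f B) u = (matCLM B).adjoint (gradient f (matCLM B u)) := by
  refine ext_inner_right ℝ fun v => ?_
  rw [inner_gradient_left, ContinuousLinearMap.adjoint_inner_left, inner_gradient_left,
    psi_eq_comp]
  have h1 : HasFDerivAt (fun u => f (matCLM B u))
      ((fderiv ℝ f (matCLM B u)).comp (matCLM B)) u :=
    ((hf.differentiable (by simp)).differentiableAt.hasFDerivAt).comp u (matCLM B).hasFDerivAt
  rw [h1.fderiv]
  rfl

lemma hessian_psi (hf : ContDiff ℝ 2 f) (B : Matrix (Fin m) ι ℝ) (u : EuclideanSpace ℝ ι) :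
    hessian (psi f B) u =
      (matCLM B).adjoint ∘L hessian f (matCLM B u) ∘L matCLM B := by
  rw [hessian, funext (gradient_psi hf B)]
  exact ((matCLM B).adjoint.hasFDerivAt.comp u
    ((hasFDerivAt_gradient hf.contDiffAt).comp u (matCLM B).hasFDerivAt)).fderiv

lemma locallyLipschitz_hessian_psi (hf : ContDiff ℝ 2 f) (hLip : LocallyLipschitz (hessian f))
    (B : Matrix (Fin m) ι ℝ) : LocallyLipschitz (hessian (psi f B)) := by
  rw [funext (hessian_psi hf B)]
  have h1 : ContDiff ℝ 1 fun T : EuclideanSpace ℝ (Fin m) →L[ℝ] EuclideanSpace ℝ (Fin m) =>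
      (matCLM B).adjoint ∘L T ∘L matCLM B :=
    contDiff_const.clm_comp (contDiff_id.clm_comp contDiff_const)
  exact h1.locallyLipschitz.comp (hLip.comp (matCLM B).lipschitz.locallyLipschitz)

end Psi

section Power

variable {q : ℝ}

lemma abs_rpow_sub_two_mul_sq {t : ℝ} (ht : t ≠ 0) : |t| ^ (q - 2) * t ^ 2 = |t| ^ q := by
  rw [← sq_abs, ← Real.rpow_natCast, ← Real.rpow_add (abs_pos.2 ht)]
  norm_num

/-- The derivative `q sign(t) |t| ^ (q - 1)`, written without the sign. -/
lemma hasDerivAt_abs_rpow_of_ne {t : ℝ} (ht : t ≠ 0) :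
    HasDerivAt (fun s => |s| ^ q) (q * (|t| ^ (q - 2) * t)) t := by
  have h := (hasDerivAt_abs ht).rpow_const (p := q) (Or.inl (abs_ne_zero.2 ht))
  convert h using 1
  have e : |t| ^ (q - 1) = |t| ^ (q - 2) * |t| := by
    rw [show q - 1 = q - 2 + 1 by ring, Real.rpow_add (abs_pos.2 ht), Real.rpow_one]
  rw [e]
  rcases lt_or_gt_of_ne ht with h0 | h0
  · simp [h0, abs_of_neg h0, mul_comm, mul_left_comm]
  · simp [h0, abs_of_pos h0, mul_comm]

lemma continuous_lqPow {ι : Type*} [Fintype ι] (hq : 0 ≤ q) :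
    Continuous (lqPow q : EuclideanSpace ℝ ι → ℝ) := by
  unfold lqPow
  fun_prop (disch := first | exact hq | exact Or.inr hq | (intros; exact Or.inr hq))

variable {ι : Type*} [Fintype ι]

lemma isOpen_forall_ne_zero : IsOpen {u : EuclideanSpace ℝ ι | ∀ i, u i ≠ 0} := by
  simp only [ofPred_forall]
  exact isOpen_iInter_of_finite fun i => isOpen_ne_fun (by fun_prop) continuous_const

lemma contDiffAt_lqPow {u : EuclideanSpace ℝ ι} (hu : ∀ i, u i ≠ 0) (k : ℕ) :
    ContDiffAt ℝ k (lqPow q) u := by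
  unfold lqPow
  refine ContDiffAt.sum fun i _ => ?_
  have h1 : ContDiffAt ℝ k (fun u : EuclideanSpace ℝ ι => u i) u :=
    (contDiff_piLp_apply 2).contDiffAt
  have h2 : ContDiffAt ℝ k (fun u : EuclideanSpace ℝ ι => |u i|) u :=
    ContDiffAt.comp u (contDiffAt_abs (hu i)) h1
  exact h2.rpow_const_of_ne (abs_ne_zero.2 (hu i))

end Power

/-! ### Derivatives of the objective -/

section Objective

variable {m : ℕ} {ι : Type*} [Fintype ι] {f : EuclideanSpace ℝ (Fin m) → ℝ} {lam q : ℝ}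
  {B : Matrix (Fin m) ι ℝ}

lemma continuous_objective (hf : ContDiff ℝ 2 f) (hq : 0 ≤ q) :
    Continuous (objective f B lam q) :=
  (contDiff_psi hf B).continuous.add ((continuous_lqPow hq).const_smul lam)

lemma contDiffAt_objective (hf : ContDiff ℝ 2 f) {u : EuclideanSpace ℝ ι} (hu : ∀ i, u i ≠ 0) :
    ContDiffAt ℝ 2 (objective f B lam q) u :=
  (contDiff_psi hf B).contDiffAt.add (contDiffAt_const.mul (contDiffAt_lqPow hu 2))

lemma gradient_apply_eq_fderiv_single [DecidableEq ι] (h : EuclideanSpace ℝ ι → ℝ)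
    (u : EuclideanSpace ℝ ι) (i : ι) :
    gradient h u i = fderiv ℝ h u (EuclideanSpace.single i 1) := by
  rw [← inner_gradient_left, EuclideanSpace.inner_single_right]
  simp

lemma gradient_objective_apply (hf : ContDiff ℝ 2 f) {u : EuclideanSpace ℝ ι}
    (hu : ∀ i, u i ≠ 0) (i : ι) :
    gradient (objective f B lam q) u i =
      gradient (psi f B) u i + lam * (q * (|u i| ^ (q - 2) * u i)) := by
  classical
  have h1 : HasFDerivAt (psi f B) (fderiv ℝ (psi f B) u) u :=
    ((contDiff_psi hf B).differentiable (by simp)).differentiableAt.hasFDerivAt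
  have h2 : HasFDerivAt (fun u : EuclideanSpace ℝ ι => lqPow q u)
      (∑ j, (q * (|u j| ^ (q - 2) * u j)) • (EuclideanSpace.proj j : _ →L[ℝ] ℝ)) u := by
    unfold lqPow
    refine HasFDerivAt.fun_sum fun j _ => ?_
    exact (hasDerivAt_abs_rpow_of_ne (hu j)).comp_hasFDerivAt u
      (EuclideanSpace.proj j : EuclideanSpace ℝ ι →L[ℝ] ℝ).hasFDerivAt
  have h3 : HasFDerivAt (objective f B lam q) _ u := h1.add (h2.const_mul lam)
  rw [gradient_apply_eq_fderiv_single, gradient_apply_eq_fderiv_single, h3.fderiv]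
  simp

lemma locallyLipschitzOn_hessian_objective (hf : ContDiff ℝ 2 f)
    (hLip : LocallyLipschitz (hessian f)) :
    LocallyLipschitzOn {u : EuclideanSpace ℝ ι | ∀ i, u i ≠ 0}
      (hessian (objective f B lam q)) := by
  have hlq : ∀ u : EuclideanSpace ℝ ι, (∀ i, u i ≠ 0) →
      ContDiffAt ℝ 3 (fun v => lam * lqPow q v) u :=
    fun u hu => contDiffAt_const.mul (contDiffAt_lqPow hu 3)
  have hgrad : ∀ u : EuclideanSpace ℝ ι, (∀ i, u i ≠ 0) →
      gradient (objective f B lam q) u =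
        gradient (psi f B) u + gradient (fun v => lam * lqPow q v) u := by
    intro u hu
    refine ext_inner_right ℝ fun v => ?_
    have h1 : DifferentiableAt ℝ (psi f B) u :=
      ((contDiff_psi hf B).differentiable (by simp)).differentiableAt
    have h2 : HasFDerivAt (objective f B lam q) _ u :=
      h1.hasFDerivAt.add ((hlq u hu).differentiableAt (by simp)).hasFDerivAt
    rw [inner_add_left, inner_gradient_left, inner_gradient_left, inner_gradient_left, h2.fderiv]
    rfl
  have hhess : ∀ u : EuclideanSpace ℝ ι, (∀ i, u i ≠ 0) →
      hessian (objective f B lam q) u =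
        hessian (psi f B) u + hessian (fun v => lam * lqPow q v) u := by
    intro u hu
    have he : gradient (objective f B lam q) =ᶠ[𝓝 u]
        fun u => gradient (psi f B) u + gradient (fun v => lam * lqPow q v) u :=
      (isOpen_forall_ne_zero.eventually_mem hu).mono hgrad
    rw [hessian, he.fderiv_eq]
    exact ((hasFDerivAt_gradient (contDiff_psi hf B).contDiffAt).add
      (hasFDerivAt_gradient ((hlq u hu).of_le (by norm_num)))).fderiv
  intro u hu
  obtain ⟨K₁, t₁, ht₁, h₁⟩ := locallyLipschitz_hessian_psi hf hLip B u
  obtain ⟨K₂, t₂, ht₂, h₂⟩ := (contDiffAt_hessian (hlq u hu)).exists_lipschitzOnWith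
  refine ⟨K₁ + K₂, t₁ ∩ t₂ ∩ {u | ∀ i, u i ≠ 0}, mem_nhdsWithin_of_mem_nhds
    (inter_mem (inter_mem ht₁ ht₂) (isOpen_forall_ne_zero.mem_nhds hu)), ?_⟩
  intro a ha b hb
  rw [hhess a ha.2, hhess b hb.2]
  exact ((h₁.mono inter_subset_left).add (h₂.mono inter_subset_right)) ha.1 hb.1

end Objective

/-! ### Restriction to the support -/

section Subspace

variable {m n : ℕ} {f : EuclideanSpace ℝ (Fin m) → ℝ} {A : Matrix (Fin m) (Fin n) ℝ} {lam q : ℝ}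

lemma extend_apply (S : Finset (Fin n)) (d : EuclideanSpace ℝ S) (i : Fin n) :
    extend S d i = if h : i ∈ S then d ⟨i, h⟩ else 0 := rfl

lemma mem_supp {x : EuclideanSpace ℝ (Fin n)} {i : Fin n} : i ∈ supp x ↔ x i ≠ 0 := by
  simp [supp]

lemma extend_restrict_supp (x : EuclideanSpace ℝ (Fin n)) :
    extend (supp x) (restrict (supp x) x) = x := by
  ext i
  rw [extend_apply]
  split_ifs with h
  · rfl
  · simpa [mem_supp, eq_comm] using h

lemma extend_add_smul (S : Finset (Fin n)) (u d : EuclideanSpace ℝ S) (t : ℝ) :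
    extend S (u + t • d) = extend S u + t • extend S d := by
  ext i
  by_cases h : i ∈ S <;> simp [extend_apply, h]

lemma sum_extend (S : Finset (Fin n)) (d : EuclideanSpace ℝ S) (φ : Fin n → ℝ → ℝ)
    (hφ : ∀ i, φ i 0 = 0) : ∑ i, φ i (extend S d i) = ∑ i : S, φ i (d i) := by
  rw [Finset.univ_eq_attach, ← Finset.sum_subset (Finset.subset_univ S), ← Finset.sum_attach]
  · exact Finset.sum_congr rfl fun i _ => by simp [extend_apply]
  · intro i _ hi
    simp [extend_apply, hi, hφ]

lemma norm_extend (S : Finset (Fin n)) (d : EuclideanSpace ℝ S) : ‖extend S d‖ = ‖d‖ := by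
  rw [EuclideanSpace.norm_eq, EuclideanSpace.norm_eq]
  congr 1
  exact sum_extend S d (fun _ t => ‖t‖ ^ 2) (by simp)

lemma matCLM_extend (S : Finset (Fin n)) (d : EuclideanSpace ℝ S) :
    matCLM A (extend S d) = matCLM (A.submatrix id (fun i : S => (i : Fin n))) d := by
  ext j
  exact sum_extend S d (fun i t => A j i * t) (by simp)

lemma objective_extend (hq : 0 < q) (S : Finset (Fin n)) (d : EuclideanSpace ℝ S) :
    objective f A lam q (extend S d) = subObjective f A lam q S d := by
  have h1 : psi f A (extend S d) = psi f (A.submatrix id (fun i : S => (i : Fin n))) d :=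
    congrArg f (matCLM_extend S d)
  have h2 : lqPow q (extend S d) = lqPow q d :=
    sum_extend S d (fun _ t => |t| ^ q) (by simp [hq.ne'])
  rw [subObjective, objective, objective, h1, h2]

lemma gradient_psi_extend (hf : ContDiff ℝ 2 f) (S : Finset (Fin n)) (d : EuclideanSpace ℝ S)
    (i : S) : gradient (psi f A) (extend S d) i =
      gradient (psi f (A.submatrix id (fun i : S => (i : Fin n)))) d i := by
  have e : ∀ (ι : Type) [Fintype ι] [DecidableEq ι] (v : EuclideanSpace ℝ ι) (i : ι),
      v i = ⟪v, EuclideanSpace.single i 1⟫_ℝ := fun ι _ _ v i => by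
    simp [EuclideanSpace.inner_single_right]
  rw [e, e, gradient_psi hf, gradient_psi hf, ContinuousLinearMap.adjoint_inner_left,
    ContinuousLinearMap.adjoint_inner_left, ← matCLM_extend, ← matCLM_extend]
  congr 2
  ext j
  by_cases h : j ∈ S
  · simp [extend_apply, h, Subtype.ext_iff]
  · have : j ≠ i := fun hj => h (hj ▸ i.2)
    simp [extend_apply, h, this]

/-- The gradient of the objective along the support of `x`, extended by zero. The derivative of
`|·| ^ q` at `t` is written as `q |t| ^ (q - 2) t`. -/
noncomputable def critVec (f : EuclideanSpace ℝ (Fin m) → ℝ) (A : Matrix (Fin m) (Fin n) ℝ)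
    (lam q : ℝ) (x : EuclideanSpace ℝ (Fin n)) : EuclideanSpace ℝ (Fin n) :=
  WithLp.toLp 2 fun i =>
    if x i = 0 then 0 else gradient (psi f A) x i + lam * (q * (|x i| ^ (q - 2) * x i))

lemma norm_critVec (hf : ContDiff ℝ 2 f) (x : EuclideanSpace ℝ (Fin n)) :
    ‖critVec f A lam q x‖ =
      ‖gradient (subObjective f A lam q (supp x)) (restrict (supp x) x)‖ := by
  rw [← norm_extend]
  congr 1
  ext i
  rw [extend_apply]
  by_cases h : i ∈ supp x
  · have hx := mem_supp.1 h
    rw [dif_pos h, subObjective,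
      gradient_objective_apply hf (u := restrict (supp x) x) (fun j => mem_supp.1 j.2),
      ← gradient_psi_extend hf, extend_restrict_supp]
    simp [critVec, hx, restrict]
  · have hx : x i = 0 := by simpa [mem_supp] using h
    simp [critVec, h, hx]

/-- Sufficient decrease of the Newton steps, uniform over bounded sets of points whose nonzero
entries are bounded away from zero. -/
lemma exists_newtonStep_decrease_objective (hf : ContDiff ℝ 2 f)
    (hLip : LocallyLipschitz (hessian f)) (hq : 0 < q) (P : Params) (R : ℝ) {a : ℝ} (ha : 0 < a) :
    ∃ c > 0, ∀ x xplus : EuclideanSpace ℝ (Fin n), ‖x‖ ≤ R → (∀ i, x i ≠ 0 → a ≤ |x i|) →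
      NewtonStep f A lam q P x xplus →
      c * ‖critVec f A lam q x‖ ^ 2 ≤ objective f A lam q x - objective f A lam q xplus := by
  have key : ∀ S : Finset (Fin n), ∃ c > 0, ∀ u : EuclideanSpace ℝ S,
      u ∈ Metric.closedBall (0 : EuclideanSpace ℝ S) R ∩ {u | ∀ i, a ≤ |u i|} →
      ∀ (d : EuclideanSpace ℝ S) (j : ℕ),
      regHessian P.b₁ P.b₂ P.sigma (subObjective f A lam q S) u d =
        -gradient (subObjective f A lam q S) u →
      IsLeast {i : ℕ | subObjective f A lam q S (u + P.beta ^ i • d) ≤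
        subObjective f A lam q S u +
          P.rho * P.beta ^ i * ⟪gradient (subObjective f A lam q S) u, d⟫_ℝ} j →
      c * ‖gradient (subObjective f A lam q S) u‖ ^ 2 ≤
        subObjective f A lam q S u - subObjective f A lam q S (u + P.beta ^ j • d) := by
    intro S
    refine exists_newtonStep_decrease P isOpen_forall_ne_zero
      ((isCompact_closedBall _ _).inter_right ?_) ?_ (fun y hy => contDiffAt_objective hf hy)
      (locallyLipschitzOn_hessian_objective hf hLip)
    · simp only [ofPred_forall]
      exact isClosed_iInter fun i => isClosed_le continuous_const (by fun_prop)
    · intro u hu i hi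
      have := hu.2 i
      rw [hi, abs_zero] at this
      linarith
  choose c hc H using key
  obtain ⟨S₀, hS₀⟩ := Finite.exists_min c
  refine ⟨c S₀, hc S₀, fun x xplus hx hxa hN => ?_⟩
  obtain ⟨d, j, h1, h2, rfl⟩ := hN
  have hx' : ‖restrict (supp x) x‖ ≤ R := by
    rw [← norm_extend, extend_restrict_supp]
    exact hx
  have h3 := H (supp x) (restrict (supp x) x)
    ⟨by simpa using hx', fun i => hxa i (mem_supp.1 i.2)⟩ d j h1 h2
  rw [← objective_extend hq, ← objective_extend hq, extend_add_smul, extend_restrict_supp,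
    ← norm_critVec hf] at h3
  exact (mul_le_mul_of_nonneg_right (hS₀ _) (sq_nonneg _)).trans h3

end Subspace

/-! ### Proximal gradient steps -/

section Prox

variable {m n : ℕ} {f : EuclideanSpace ℝ (Fin m) → ℝ} {A : Matrix (Fin m) (Fin n) ℝ} {lam q : ℝ}

lemma lqPow_nonneg {ι : Type*} [Fintype ι] (u : EuclideanSpace ℝ ι) : 0 ≤ lqPow q u :=
  Finset.sum_nonneg fun _ _ => by positivity

lemma prox_minimality {E : Type*} [NormedAddCommGroup E] [InnerProductSpace ℝ E] {μ : ℝ}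
    (hμ : 0 < μ) {h : E → ℝ} {x p y : E} (hy : y ∈ prox μ⁻¹ h (x - μ⁻¹ • p)) (z : E) :
    ⟪p, y - x⟫_ℝ + μ / 2 * ‖y - x‖ ^ 2 + h y ≤ ⟪p, z - x⟫_ℝ + μ / 2 * ‖z - x‖ ^ 2 + h z := by
  have key : ∀ z : E, 1 / (2 * μ⁻¹) * ‖z - (x - μ⁻¹ • p)‖ ^ 2 =
      ⟪p, z - x⟫_ℝ + μ / 2 * ‖z - x‖ ^ 2 + 1 / (2 * μ) * ‖p‖ ^ 2 := by
    intro z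
    rw [show z - (x - μ⁻¹ • p) = (z - x) + μ⁻¹ • p by abel, norm_add_sq_real,
      real_inner_smul_right, norm_smul, Real.norm_of_nonneg (by positivity), real_inner_comm p]
    field_simp
    ring
  have h1 := hy z
  rw [key, key] at h1
  linarith

/-- `prox_minimality` against a change of the single entry `i` by `s`. -/
lemma prox_coord_minimality {μ : ℝ} (hμ : 0 < μ) {x p y : EuclideanSpace ℝ (Fin n)}
    (hy : y ∈ prox μ⁻¹ (fun z => lam * lqPow q z) (x - μ⁻¹ • p)) (i : Fin n) (s : ℝ) :
    0 ≤ s * (p i + μ * (y i - x i)) + μ / 2 * s ^ 2 + lam * (|y i + s| ^ q - |y i| ^ q) := by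
  have h1 := prox_minimality hμ hy (y + EuclideanSpace.single i s)
  have e1 : y + EuclideanSpace.single i s - x = (y - x) + EuclideanSpace.single i s := by abel
  have e2 : lqPow q (y + EuclideanSpace.single i s) =
      lqPow q y + (|y i + s| ^ q - |y i| ^ q) := by
    rw [lqPow, lqPow, ← sub_eq_iff_eq_add', ← Finset.sum_sub_distrib,
      Finset.sum_eq_single i]
    · simp
    · intro j _ hj
      simp [hj]
    · simp
  rw [e1, e2, inner_add_right, norm_add_sq_real, EuclideanSpace.inner_single_right,
    EuclideanSpace.inner_single_right, PiLp.norm_single, Real.norm_eq_abs, sq_abs] at h1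
  simp only [PiLp.sub_apply, conj_trivial] at h1
  linarith

lemma prox_stationarity {μ : ℝ} (hμ : 0 < μ) {x p y : EuclideanSpace ℝ (Fin n)}
    (hy : y ∈ prox μ⁻¹ (fun z => lam * lqPow q z) (x - μ⁻¹ • p)) {i : Fin n} (hi : y i ≠ 0) :
    p i + μ * (y i - x i) + lam * (q * (|y i| ^ (q - 2) * y i)) = 0 := by
  have hd : HasDerivAt (fun s : ℝ => s * (p i + μ * (y i - x i)) + μ / 2 * s ^ 2 +
      lam * (|y i + s| ^ q - |y i| ^ q))
      (p i + μ * (y i - x i) + lam * (q * (|y i| ^ (q - 2) * y i))) 0 := by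
    have h1 : HasDerivAt (fun s : ℝ => |y i + s| ^ q) (q * (|y i| ^ (q - 2) * y i)) 0 := by
      have h2 : HasDerivAt (fun s : ℝ => |s| ^ q) (q * (|y i| ^ (q - 2) * y i)) (y i + 0) := by
        simpa using hasDerivAt_abs_rpow_of_ne hi
      exact h2.comp_const_add (y i) 0
    have h3 := (((hasDerivAt_id (0 : ℝ)).mul_const (p i + μ * (y i - x i))).add
      (((hasDerivAt_id (0 : ℝ)).pow 2).const_mul (μ / 2))).add
      ((h1.sub_const (|y i| ^ q)).const_mul lam)
    refine h3.congr_deriv ?_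
    simp
  refine IsLocalMin.hasDerivAt_eq_zero (Filter.Eventually.of_forall fun s => ?_) hd
  simpa using prox_coord_minimality hμ hy i s

/-- The nonzero entries of a proximal point are bounded away from zero: comparing the value of the
proximal objective with its value after deletion of the entry gives a bound that is stronger than
the second-order condition. -/
lemma prox_entry_bound {μ : ℝ} (hμ : 0 < μ) (hq : 0 < q) {x p y : EuclideanSpace ℝ (Fin n)}
    (hy : y ∈ prox μ⁻¹ (fun z => lam * lqPow q z) (x - μ⁻¹ • p)) {i : Fin n} (hi : y i ≠ 0) :
    lam * (1 - q) * |y i| ^ (q - 2) ≤ μ / 2 := by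
  have h1 := prox_stationarity hμ hy hi
  have h2 := prox_coord_minimality hμ hy i (-y i)
  have e := abs_rpow_sub_two_mul_sq (q := q) hi
  rw [add_neg_cancel, abs_zero, Real.zero_rpow hq.ne', ← e] at h2
  have h3 : p i + μ * (y i - x i) = -(lam * (q * (|y i| ^ (q - 2) * y i))) := by linarith
  rw [h3] at h2
  have hpos : 0 < y i ^ 2 := by positivity
  refine le_of_mul_le_mul_right ?_ hpos
  linarith

lemma norm_le_norm_of_abs_le {ι : Type*} [Fintype ι] {u v : EuclideanSpace ℝ ι}
    (h : ∀ i, |u i| ≤ |v i|) : ‖u‖ ≤ ‖v‖ := by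
  rw [EuclideanSpace.norm_eq, EuclideanSpace.norm_eq]
  refine Real.sqrt_le_sqrt (Finset.sum_le_sum fun i _ => ?_)
  simpa using sq_le_sq.2 (by simpa using h i)

lemma norm_critVec_prox_le {μ : ℝ} (hμ : 0 < μ) {x y : EuclideanSpace ℝ (Fin n)}
    (hy : y ∈ prox μ⁻¹ (fun z => lam * lqPow q z) (x - μ⁻¹ • gradient (psi f A) x)) :
    ‖critVec f A lam q y‖ ≤
      ‖gradient (psi f A) y - gradient (psi f A) x‖ + μ * ‖y - x‖ := by
  have h1 : ‖critVec f A lam q y‖ ≤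
      ‖gradient (psi f A) y - gradient (psi f A) x - μ • (y - x)‖ := by
    refine norm_le_norm_of_abs_le fun i => ?_
    by_cases hi : y i = 0
    · simp [critVec, hi]
    · have := prox_stationarity hμ hy hi
      refine le_of_eq (congrArg _ ?_)
      simp only [critVec, hi, if_false, PiLp.sub_apply, PiLp.smul_apply, smul_eq_mul]
      linarith
  refine h1.trans ((norm_sub_le _ _).trans_eq ?_)
  rw [norm_smul, Real.norm_of_nonneg hμ.le]

/-- The sublevel sets of the objective are bounded. -/
lemma exists_norm_le_of_objective_le (hf_bdd : BddBelow (Set.range f)) (hlam : 0 < lam)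
    (hq : 0 < q) (c : ℝ) :
    ∃ R, ∀ z : EuclideanSpace ℝ (Fin n), objective f A lam q z ≤ c → ‖z‖ ≤ R := by
  obtain ⟨b, hb⟩ := hf_bdd
  set r : EuclideanSpace ℝ (Fin n) := WithLp.toLp 2 fun _ => (|c - b| / lam) ^ q⁻¹ with hr
  refine ⟨‖r‖, fun z hz => norm_le_norm_of_abs_le fun i => ?_⟩
  have h1 : b ≤ psi f A z := hb ⟨_, rfl⟩
  have h2 : |z i| ^ q ≤ lqPow q z :=
    Finset.single_le_sum (f := fun i => |z i| ^ q) (fun _ _ => by positivity) (Finset.mem_univ i)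
  have h3 : |z i| ^ q ≤ |c - b| / lam := by
    rw [le_div_iff₀ hlam]
    have h4 : lam * |z i| ^ q ≤ lam * lqPow q z := by gcongr
    have h5 : psi f A z + lam * lqPow q z ≤ c := hz
    have := le_abs_self (c - b)
    linarith
  have h6 : (|z i| ^ q) ^ q⁻¹ ≤ (|c - b| / lam) ^ q⁻¹ :=
    Real.rpow_le_rpow (by positivity) h3 (by positivity)
  rw [Real.rpow_rpow_inv (abs_nonneg _) hq.ne'] at h6
  exact h6.trans (le_abs_self _)

lemma exists_gradient_lipschitzOn {E : Type*} [NormedAddCommGroup E] [InnerProductSpace ℝ E]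
    [FiniteDimensional ℝ E] {h : E → ℝ} (hh : ContDiff ℝ 2 h) (R : ℝ) :
    ∃ L ≥ 0, ∀ x y : E, ‖x‖ ≤ R → ‖y‖ ≤ R → ‖gradient h x - gradient h y‖ ≤ L * ‖x - y‖ := by
  have h1 : ContDiff ℝ 1 (gradient h) := contDiff_iff_contDiffAt.2 fun u =>
    contDiffAt_gradient (k := 1) (by simpa using hh.contDiffAt)
  obtain ⟨L, hL⟩ := h1.locallyLipschitz.locallyLipschitzOn.exists_lipschitzOnWith_of_compact
    (isCompact_closedBall (0 : E) R)
  exact ⟨L, L.coe_nonneg, fun x y hx hy => by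
    simpa [dist_eq_norm] using hL.dist_le_mul x (by simpa using hx) y (by simpa using hy)⟩

lemma sub_le_of_gradient_lipschitz {E : Type*} [NormedAddCommGroup E] [InnerProductSpace ℝ E]
    [CompleteSpace E] {h : E → ℝ} (hh : Differentiable ℝ h) {L : ℝ} (hL : 0 ≤ L) {x y : E}
    (hLip : ∀ z, ‖z - x‖ ≤ ‖y - x‖ → ‖gradient h z - gradient h x‖ ≤ L * ‖z - x‖) :
    h y ≤ h x + ⟪gradient h x, y - x⟫_ℝ + L * ‖y - x‖ ^ 2 := by
  have h1 := (convex_closedBall x ‖y - x‖).norm_image_sub_le_of_norm_fderiv_le' (𝕜 := ℝ) (f := h)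
    (φ := fderiv ℝ h x) (C := L * ‖y - x‖) (x := x) (y := y) (fun z _ => hh z)
    (fun z hz => by
      have hz' : ‖z - x‖ ≤ ‖y - x‖ := by simpa [dist_eq_norm] using hz
      have e : fderiv ℝ h z - fderiv ℝ h x = innerSL ℝ (gradient h z - gradient h x) := by
        ext v
        simp [inner_gradient_left]
      rw [e, innerSL_apply_norm]
      exact (hLip z hz').trans (by gcongr)) (by simp) (by simp [dist_eq_norm])
  rw [← inner_gradient_left] at h1
  have := (abs_le.1 h1).2
  have e : L * ‖y - x‖ * ‖y - x‖ = L * ‖y - x‖ ^ 2 := by ring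
  linarith

/-- The accepted step-size parameters are bounded over bounded sets: trial points stay in a bounded
set, on which `∇ψ` is Lipschitz, so large parameters are never rejected. -/
lemma exists_stepsize_le (hf : ContDiff ℝ 2 f) (hlam : 0 < lam) (hq : 0 < q) (P : Params) (R : ℝ) :
    ∃ M > 0, ∀ (x xplus : EuclideanSpace ℝ (Fin n)) (mu muplus : ℝ), ‖x‖ ≤ R →
      mu ∈ Icc P.muMin P.muMax → PGStep f A lam q P.tau P.alpha x mu xplus muplus →
      muplus ≤ M := by
  have hτ : 0 < P.tau := zero_lt_one.trans P.one_lt_tau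
  have hα := P.alpha_pos
  have hm := P.muMin_pos
  have hψ : ContDiff ℝ 2 (psi f A) := contDiff_psi hf A
  have hball := isCompact_closedBall (0 : EuclideanSpace ℝ (Fin n)) R
  obtain ⟨G, hG⟩ := hball.exists_bound_of_continuousOn (f := gradient (psi f A)) fun y _ =>
    (hasFDerivAt_gradient hψ.contDiffAt).continuousAt.continuousWithinAt
  obtain ⟨C, hC⟩ := hball.exists_bound_of_continuousOn (f := lqPow q)
    (continuous_lqPow hq.le).continuousOn
  -- By minimality against `x`, the trial points lie within distance `T` of `x`.
  set T : ℝ := 1 + 2 * (|G| + lam * |C|) / P.muMin with hT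
  have hT1 : 1 ≤ T := by
    have : 0 ≤ 2 * (|G| + lam * |C|) / P.muMin := by positivity
    linarith
  obtain ⟨L, hL0, hL⟩ := exists_gradient_lipschitzOn hψ (R + T)
  refine ⟨max P.muMax (P.tau * (2 * L + P.alpha)), by positivity, ?_⟩
  rintro x xplus mu muplus hx ⟨hmu1, hmu2⟩ ⟨l, y, hprox, hrej, -, -, rfl⟩
  rcases Nat.eq_zero_or_pos l with rfl | hl
  · simpa using Or.inl hmu2
  obtain ⟨k, rfl⟩ := Nat.exists_eq_succ_of_ne_zero hl.ne'
  refine le_max_of_le_right ?_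
  rw [Nat.succ_eq_add_one, pow_succ', mul_assoc]
  refine mul_le_mul_of_nonneg_left ?_ hτ.le
  -- The last rejected parameter; its rejection forces `μ' < 2 * L + α`.
  set μ' := P.tau ^ k * mu with hμ'
  have hmm : P.muMin ≤ μ' :=
    hmu1.trans (le_mul_of_one_le_left (hm.le.trans hmu1) (one_le_pow₀ P.one_lt_tau.le))
  have hμ'0 : 0 < μ' := hm.trans_le hmm
  have h1 := prox_minimality hμ'0 (hprox k (Nat.le_succ k)) x
  have h2 := hrej k (Nat.lt_succ_self k)
  set s := ‖y k - x‖ with hs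
  simp only [sub_self, inner_zero_right, norm_zero, ne_eq, OfNat.ofNat_ne_zero, not_false_eq_true,
    zero_pow, mul_zero, add_zero, zero_add] at h1
  have hxb : x ∈ Metric.closedBall (0 : EuclideanSpace ℝ (Fin n)) R := by simpa using hx
  have hsT : s ≤ T := by
    by_contra! hcon
    have h3 : -(|G| * s) ≤ ⟪gradient (psi f A) x, y k - x⟫_ℝ := by
      have h4 := (abs_le.1 (abs_real_inner_le_norm (gradient (psi f A) x) (y k - x))).1
      have h5 : ‖gradient (psi f A) x‖ * s ≤ |G| * s := by
        gcongr
        exact (hG x hxb).trans (le_abs_self G)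
      linarith
    have h6 : lam * lqPow q x ≤ lam * |C| := by
      have := (le_abs_self _).trans ((hC x hxb).trans (le_abs_self C))
      gcongr
    have h7 : 0 ≤ lam * lqPow q (y k) := mul_nonneg hlam.le (lqPow_nonneg _)
    have h8 : P.muMin / 2 * s ^ 2 ≤ μ' / 2 * s ^ 2 := by gcongr
    have h9 : |G| + lam * |C| < P.muMin / 2 * s := by
      have : 2 * (|G| + lam * |C|) / P.muMin < s := by linarith
      rw [div_lt_iff₀ hm] at this
      linarith
    have hs1 : 1 < s := hT1.trans_lt hcon
    have h10 : (|G| + lam * |C|) * s < P.muMin / 2 * s * s := by gcongr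
    have h11 : lam * |C| ≤ lam * |C| * s := le_mul_of_one_le_right (by positivity) hs1.le
    linarith [sq s]
  have h3 := sub_le_of_gradient_lipschitz (hψ.differentiable (by simp)) hL0 (x := x) (y := y k)
    (fun z hz => hL z x (by
      have := norm_add_le (z - x) x
      rw [sub_add_cancel] at this
      linarith) (by linarith))
  rw [objective, objective] at h2
  by_contra! hcon
  have h4 : (2 * L + P.alpha) * s ^ 2 ≤ μ' * s ^ 2 := by gcongr
  linarith

/-- The switching test keeps the nonzero entries of `x` away from zero. -/
lemma le_abs_of_switchTest (hlam : 0 < lam) (hq0 : 0 < q) (hq1 : q < 1) {M μ : ℝ} (hM : 0 < M)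
    (hμ : 0 < μ) (hμM : μ ≤ M) {x xbar : EuclideanSpace ℝ (Fin n)}
    (hbar : ∀ i, xbar i ≠ 0 → lam * (1 - q) * |xbar i| ^ (q - 2) ≤ μ / 2)
    (hsw : SwitchTest lam q x xbar μ) {i : Fin n} (hi : x i ≠ 0) :
    (M / (lam * q * (1 - q))) ^ (q - 2)⁻¹ ≤ |x i| := by
  obtain ⟨hsign, hcurv⟩ := hsw
  have h1q : 0 < 1 - q := by linarith
  have hbi : xbar i ≠ 0 := by
    rw [← sign_ne_zero, ← hsign i]
    exact sign_ne_zero.2 hi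
  have hatt : ∀ z : EuclideanSpace ℝ (Fin n), z i ≠ 0 → ∃ j, z j ≠ 0 ∧ |z j| = absMin z := by
    intro z hz
    have : Nonempty (supp z) := ⟨⟨i, mem_supp.2 hz⟩⟩
    obtain ⟨j, hj⟩ := exists_eq_ciInf_of_finite (f := fun j : supp z => |z j|)
    exact ⟨j, mem_supp.1 j.2, hj⟩
  obtain ⟨j, hj0, hj⟩ := hatt xbar hbi
  obtain ⟨k, hk0, hk⟩ := hatt x hi
  have hki : |x k| ≤ |x i| := by
    rw [hk]
    exact ciInf_le (finite_range _).bddBelow (⟨i, mem_supp.2 hi⟩ : supp x)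
  refine le_trans ?_ hki
  rw [← hj, ← hk] at hcurv
  have h1 := mul_le_mul_of_nonneg_left (hbar j hj0) hq0.le
  have h2 : q * (μ / 2) ≤ μ / 2 := mul_le_of_le_one_left (by positivity) hq1.le
  have h3 : |x k| ^ (q - 2) ≤ M / (lam * q * (1 - q)) := by
    rw [le_div_iff₀ (by positivity)]
    linarith
  have h4 := Real.rpow_le_rpow_of_nonpos (Real.rpow_pos_of_pos (abs_pos.2 hk0) _) h3
    (inv_nonpos.2 (by linarith : q - 2 ≤ 0))
  rwa [Real.rpow_rpow_inv (abs_nonneg _) (by linarith)] at h4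

end Prox

/-! ### Subgradients and the KL inequality -/

section Subdifferential

variable {m n : ℕ} {f : EuclideanSpace ℝ (Fin m) → ℝ} {A : Matrix (Fin m) (Fin n) ℝ} {lam q : ℝ}

/-- The derivative `w` of `|·| ^ q` at `a ≠ 0`, and every `w` at `a = 0`, is a regular
subgradient. -/
lemma eventually_abs_rpow_ge (hq0 : 0 < q) (hq1 : q < 1) {a w ε : ℝ} (hε : 0 < ε)
    (hw : a ≠ 0 → w = q * (|a| ^ (q - 2) * a)) :
    ∀ᶠ t in 𝓝 a, |a| ^ q + w * (t - a) - ε * |t - a| ≤ |t| ^ q := by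
  rcases eq_or_ne a 0 with rfl | ha
  · have hc : Continuous fun t : ℝ => |w| * |t| ^ (1 - q) :=
      continuous_const.mul (continuous_abs.rpow_const fun _ => Or.inr (by linarith))
    have hev : ∀ᶠ t in 𝓝 (0 : ℝ), |w| * |t| ^ (1 - q) < 1 := by
      refine hc.continuousAt.eventually_lt continuousAt_const ?_
      simp [Real.zero_rpow (by linarith : 1 - q ≠ 0)]
    filter_upwards [hev] with t ht
    have h1 : |t| = |t| ^ (1 - q) * |t| ^ q := by
      rw [← Real.rpow_add_of_nonneg (abs_nonneg t) (by linarith) hq0.le]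
      simp
    have h2 : w * t ≤ |t| ^ q := by
      calc w * t ≤ |w| * |t| := (le_abs_self _).trans_eq (abs_mul w t)
        _ = (|w| * |t| ^ (1 - q)) * |t| ^ q := by rw [mul_assoc, ← h1]
        _ ≤ 1 * |t| ^ q := by gcongr
        _ = |t| ^ q := one_mul _
    have h3 : 0 ≤ ε * |t| := by positivity
    simp only [abs_zero, Real.zero_rpow hq0.ne', sub_zero]
    linarith
  · have h1 := (hasDerivAt_iff_isLittleO.1 (hasDerivAt_abs_rpow_of_ne (q := q) ha)).def hε
    filter_upwards [h1] with t ht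
    rw [hw ha]
    rw [Real.norm_eq_abs, Real.norm_eq_abs, smul_eq_mul] at ht
    have := (abs_le.1 ht).1
    linarith

lemma critVec_mem_regularSubdiff (hf : ContDiff ℝ 2 f) (hlam : 0 < lam) (hq0 : 0 < q)
    (hq1 : q < 1) (x : EuclideanSpace ℝ (Fin n)) :
    critVec f A lam q x ∈ regularSubdiff (objective f A lam q) x := by
  intro ε hε
  set p := gradient (psi f A) x with hp
  -- The slope chosen for `|·| ^ q` in each coordinate; at zero entries it cancels the gradient of
  -- the smooth part.
  set w : Fin n → ℝ := fun i =>
    if x i = 0 then -(p i / lam) else q * (|x i| ^ (q - 2) * x i) with hw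
  set ε' := ε / (2 * lam * (n + 1)) with hε'
  have hε'0 : 0 < ε' := by positivity
  have hcoord : ∀ i, ∀ᶠ y in 𝓝 x,
      |x i| ^ q + w i * (y i - x i) - ε' * |y i - x i| ≤ |y i| ^ q := by
    intro i
    have hc : Tendsto (fun y : EuclideanSpace ℝ (Fin n) => y i) (𝓝 x) (𝓝 (x i)) :=
      Continuous.tendsto (by fun_prop) x
    exact hc.eventually (eventually_abs_rpow_ge hq0 hq1 hε'0 fun h => by simp [hw, h])
  have hψ := ((hasGradientAt_iff_isLittleO.1
    (((contDiff_psi hf A).differentiable (by simp)).differentiableAt (x := x)).hasGradientAt).def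
    (half_pos hε))
  filter_upwards [hψ, eventually_all.2 hcoord] with y hy1 hy2
  have e1 : ⟪critVec f A lam q x, y - x⟫_ℝ = ⟪p, y - x⟫_ℝ + lam * ∑ i, w i * (y i - x i) := by
    simp only [PiLp.inner_apply, RCLike.inner_apply, conj_trivial, PiLp.sub_apply]
    rw [Finset.mul_sum, ← Finset.sum_add_distrib]
    refine Finset.sum_congr rfl fun i _ => ?_
    by_cases hi : x i = 0
    · simp only [critVec, hw, hi, if_true]
      field_simp
      ring
    · simp only [critVec, hw, hi, if_false, ← hp]
      ring
  have e2 : lqPow q x + ∑ i, w i * (y i - x i) - ε' * (n * ‖y - x‖) ≤ lqPow q y := by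
    have h1 : ∑ i, |y i - x i| ≤ n * ‖y - x‖ := by
      have := Finset.sum_le_card_nsmul Finset.univ (fun i => |y i - x i|) ‖y - x‖
        (fun i _ => by simpa using PiLp.norm_apply_le (y - x) i)
      simpa using this
    have h2 := Finset.sum_le_sum fun i (_ : i ∈ Finset.univ) => hy2 i
    rw [Finset.sum_sub_distrib, Finset.sum_add_distrib, ← Finset.mul_sum] at h2
    have h3 := mul_le_mul_of_nonneg_left h1 hε'0.le
    unfold lqPow
    linarith
  have e3 : lam * (ε' * (n * ‖y - x‖)) ≤ ε / 2 * ‖y - x‖ := by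
    have : lam * (ε' * (n * ‖y - x‖)) = ε / 2 * ‖y - x‖ * (n / (n + 1)) := by
      rw [hε']
      field_simp
    rw [this]
    refine mul_le_of_le_one_right (by positivity) ?_
    rw [div_le_one (by positivity)]
    linarith
  have h1 := (abs_le.1 hy1).1
  have h2 := mul_le_mul_of_nonneg_left e2 hlam.le
  rw [e1, objective, objective]
  linarith

lemma regularSubdiff_subset_limitingSubdiff {E : Type*} [NormedAddCommGroup E]
    [InnerProductSpace ℝ E] (h : E → ℝ) (x : E) : regularSubdiff h x ⊆ limitingSubdiff h x :=
  fun v hv => ⟨fun _ => x, fun _ => v, tendsto_const_nhds, tendsto_const_nhds, fun _ => hv,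
    tendsto_const_nhds⟩

/-- The KL inequality with `φ s = c √s`, evaluated at a single subgradient. -/
lemma KLInequality.sub_le_mul_norm_sq {E : Type*} [NormedAddCommGroup E] [InnerProductSpace ℝ E]
    {h : E → ℝ} {c : ℝ} {z : E} (hc : 0 < c) (hKL : KLInequality h (fun s => c * √s) z) :
    ∃ η > 0, ∀ᶠ x in 𝓝 z, h z < h x → h x < h z + η → ∀ v ∈ limitingSubdiff h x,
      h x - h z ≤ (c / 2) ^ 2 * ‖v‖ ^ 2 := by
  obtain ⟨η, hη, U, hU, H⟩ := hKL
  refine ⟨η, hη, mem_of_superset hU fun x hx h1 h2 v hv => ?_⟩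
  have hs : 0 < h x - h z := by linarith
  have h3 := H x hx h1 h2
  have hd : deriv (fun s => c * √s) (h x - h z) = c / (2 * √(h x - h z)) := by
    rw [((Real.hasDerivAt_sqrt hs.ne').const_mul c).deriv]
    ring
  have h4 : Metric.infEDist 0 (limitingSubdiff h x) ≤ ENNReal.ofReal ‖v‖ := by
    refine (Metric.infEDist_le_edist_of_mem hv).trans_eq ?_
    rw [edist_dist, dist_zero_left]
  rw [hd] at h3
  have h5 := h3.trans (mul_le_mul_right h4 _)
  rw [← ENNReal.ofReal_mul (by positivity), ENNReal.one_le_ofReal] at h5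
  have hsq : 0 < √(h x - h z) := Real.sqrt_pos.2 hs
  have h6 : √(h x - h z) ≤ c / 2 * ‖v‖ := by
    have h7 : c / (2 * √(h x - h z)) * ‖v‖ = (c / 2 * ‖v‖) / √(h x - h z) := by
      field_simp
    rwa [h7, le_div_iff₀ hsq, one_mul] at h5
  calc h x - h z = √(h x - h z) ^ 2 := (Real.sq_sqrt hs.le).symm
    _ ≤ (c / 2 * ‖v‖) ^ 2 := by gcongr
    _ = (c / 2) ^ 2 * ‖v‖ ^ 2 := by ring

/-- Along a bounded sequence with convergent values, the KL inequality of exponent `1 / 2` holds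
with a constant that does not depend on the cluster point. -/
lemma IsKLFunctionHalf.exists_uniform {E : Type*} [NormedAddCommGroup E] [InnerProductSpace ℝ E]
    [FiniteDimensional ℝ E] {h : E → ℝ} (hKL : IsKLFunctionHalf h) (hcont : Continuous h)
    (hne : ∀ x, (limitingSubdiff h x).Nonempty) {x : ℕ → E} {R a : ℝ} (hx : ∀ k, ‖x k‖ ≤ R)
    (ha : Tendsto (fun k => h (x k)) atTop (𝓝 a)) :
    ∃ C > 0, ∃ K : ℕ, ∀ k ≥ K, a < h (x k) → ∀ v ∈ limitingSubdiff h (x k),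
      h (x k) - a ≤ C * ‖v‖ ^ 2 := by
  by_contra! hcon
  have hcon' : ∀ N : ℕ, ∃ k ≥ N, a < h (x k) ∧ ∃ v ∈ limitingSubdiff h (x k),
      ((N : ℝ) + 1) * ‖v‖ ^ 2 < h (x k) - a := fun N => hcon (N + 1) (by positivity) N
  choose k hk hak v hv hlt using hcon'
  obtain ⟨z, -, φ, hφ, hz⟩ := (isCompact_closedBall (0 : E) R).tendsto_subseq
    (x := fun N => x (k N)) (fun N => by simpa using hx (k N))
  have hkφ : Tendsto (fun N => k (φ N)) atTop atTop :=
    tendsto_atTop_mono (fun N => hk (φ N)) hφ.tendsto_atTop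
  have hvals : Tendsto (fun N => h (x (k (φ N)))) atTop (𝓝 a) := ha.comp hkφ
  have hza : h z = a := tendsto_nhds_unique ((hcont.tendsto z).comp hz) hvals
  obtain ⟨c, hc, hKLz⟩ := hKL z (hne z)
  obtain ⟨η, hη, hev⟩ := hKLz.sub_le_mul_norm_sq hc
  have h1 : ∀ᶠ N in atTop, h (x (k (φ N))) < h z + η :=
    hvals.eventually_lt_const (by linarith)
  have h2 : ∀ᶠ N in atTop, (c / 2) ^ 2 ≤ ((φ N : ℕ) : ℝ) :=
    (tendsto_natCast_atTop_atTop.comp hφ.tendsto_atTop).eventually_ge_atTop _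
  obtain ⟨N, hN1, hN2, hN3⟩ := (h1.and (h2.and (hz.eventually hev))).exists
  have h3 := hN3 (by rw [hza]; exact hak (φ N)) hN1 (v (φ N)) (hv (φ N))
  have h4 := hlt (φ N)
  have h5 : (c / 2) ^ 2 * ‖v (φ N)‖ ^ 2 ≤ (((φ N : ℕ) : ℝ) + 1) * ‖v (φ N)‖ ^ 2 := by
    gcongr
    linarith
  simp only [Function.comp_apply, hza] at h3
  linarith

end Subdifferential

/-! ### Rate of convergence along a run -/

lemma convergesQLinearly_of_sub_le {a : ℕ → ℝ} {L C : ℝ} {K : ℕ} (hanti : Antitone a)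
    (ha : Tendsto a atTop (𝓝 L)) (hC : 0 < C)
    (h : ∀ k ≥ K, a (k + 1) - L ≤ C * (a k - a (k + 1))) : ConvergesQLinearly a L := by
  refine ⟨ha, C / (1 + C), by positivity, (div_lt_one (by positivity)).2 (by linarith), K,
    fun k hk => ?_⟩
  have hL : ∀ j, 0 ≤ a j - L := fun j => sub_nonneg.2 (hanti.le_of_tendsto ha j)
  rw [abs_of_nonneg (hL _), abs_of_nonneg (hL _), div_mul_eq_mul_div, le_div_iff₀ (by positivity)]
  linarith [h k hk]

section Run

variable {m n : ℕ} {f : EuclideanSpace ℝ (Fin m) → ℝ} {A : Matrix (Fin m) (Fin n) ℝ} {lam q : ℝ}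

lemma PGStep.spec {tau alpha mu muplus : ℝ} {x xplus : EuclideanSpace ℝ (Fin n)}
    (htau : 0 < tau) (hmu : 0 < mu) (h : PGStep f A lam q tau alpha x mu xplus muplus) :
    0 < muplus ∧
    xplus ∈ prox muplus⁻¹ (fun z => lam * lqPow q z) (x - muplus⁻¹ • gradient (psi f A) x) ∧
    objective f A lam q xplus ≤ objective f A lam q x - alpha / 2 * ‖xplus - x‖ ^ 2 := by
  obtain ⟨l, y, hy, -, hdec, rfl, rfl⟩ := h
  exact ⟨by positivity, hy l le_rfl, hdec⟩

/-- On a sublevel set, every iteration decreases the objective by at least a multiple of the squared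
norm of `critVec` at the new iterate (proximal gradient step) or at the old one (Newton step). -/
lemma exists_step_decrease (hf : ContDiff ℝ 2 f) (hf_bdd : BddBelow (Set.range f))
    (hlam : 0 < lam) (hq0 : 0 < q) (hq1 : q < 1) (hLip : LocallyLipschitz (hessian f))
    {P : Params} {x xbar : ℕ → EuclideanSpace ℝ (Fin n)} {mu mubar : ℕ → ℝ}
    (hrun : IsInfiniteRun f A lam q P x xbar mu mubar) (c₀ : ℝ) :
    ∃ C > 0, ∀ k, objective f A lam q (x k) ≤ c₀ →
      ‖critVec f A lam q (x (k + 1))‖ ^ 2 ≤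
        C * (objective f A lam q (x k) - objective f A lam q (x (k + 1))) ∨
      ‖critVec f A lam q (x k)‖ ^ 2 ≤
        C * (objective f A lam q (x k) - objective f A lam q (x (k + 1))) := by
  obtain ⟨R, hR⟩ := exists_norm_le_of_objective_le (n := n) (A := A) hf_bdd hlam hq0 c₀
  obtain ⟨M, hM, hmuM⟩ := exists_stepsize_le (A := A) hf hlam hq0 P R
  obtain ⟨L, hL0, hL⟩ := exists_gradient_lipschitzOn (contDiff_psi hf A) R
  have h1q : 0 < 1 - q := by linarith
  obtain ⟨c, hc, hN⟩ := exists_newtonStep_decrease_objective (A := A) (lam := lam) hf hLip hq0 P R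
    (a := (M / (lam * q * (1 - q))) ^ (q - 2)⁻¹) (by positivity)
  have hα := P.alpha_pos
  set C₁ := (L + M) ^ 2 * (2 / P.alpha) with hC₁
  have hC₁0 : 0 < C₁ := by positivity
  refine ⟨C₁ + 1 / c, by positivity, fun k hk => ?_⟩
  have hxR := hR _ hk
  obtain ⟨hpos, hprox, hdec⟩ := (hrun.pgStep k).spec (zero_lt_one.trans P.one_lt_tau)
    (P.muMin_pos.trans_le (hrun.mu_mem k).1)
  have hmb := hmuM _ _ _ _ hxR (hrun.mu_mem k) (hrun.pgStep k)
  by_cases hsw : SwitchTest lam q (x k) (xbar k) (mubar k)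
  · right
    have h1 := hN _ _ hxR (fun i hi => le_abs_of_switchTest hlam hq0 hq1 hM hpos hmb
      (fun j hj => prox_entry_bound hpos hq0 hprox hj) hsw hi) (hrun.step_newton k hsw)
    set D := objective f A lam q (x k) - objective f A lam q (x (k + 1))
    have hD : 0 ≤ D := le_trans (by positivity) h1
    have h2 : ‖critVec f A lam q (x k)‖ ^ 2 ≤ 1 / c * D := by
      rw [one_div, inv_mul_eq_div, le_div_iff₀ hc]
      linarith
    have h3 : 0 ≤ C₁ * D := by positivity
    linarith
  · left
    rw [hrun.step_pg k hsw]
    set s := ‖xbar k - x k‖ with hs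
    have hbR : ‖xbar k‖ ≤ R := hR _ (hdec.trans (by
      have : 0 ≤ P.alpha / 2 * s ^ 2 := by positivity
      linarith))
    have h1 : ‖critVec f A lam q (xbar k)‖ ≤ (L + M) * s := by
      refine (norm_critVec_prox_le hpos hprox).trans ?_
      rw [add_mul]
      exact add_le_add (hL _ _ hbR hxR) (by gcongr)
    set D := objective f A lam q (x k) - objective f A lam q (xbar k)
    have h2 : s ^ 2 ≤ 2 / P.alpha * D := by
      rw [div_mul_eq_mul_div, le_div_iff₀ hα]
      linarith
    have hD : 0 ≤ D := le_trans (by positivity : 0 ≤ P.alpha / 2 * s ^ 2) (by linarith)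
    calc ‖critVec f A lam q (xbar k)‖ ^ 2 ≤ ((L + M) * s) ^ 2 := by gcongr
      _ = (L + M) ^ 2 * s ^ 2 := by ring
      _ ≤ (L + M) ^ 2 * (2 / P.alpha * D) := by gcongr
      _ = C₁ * D := by ring
      _ ≤ (C₁ + 1 / c) * D := by
        gcongr
        have : 0 < 1 / c := by positivity
        linarith

end Run

end HpgSRN

theorem mainTheorem3 {m n : ℕ}
    (f : EuclideanSpace ℝ (Fin m) → ℝ) (A : Matrix (Fin m) (Fin n) ℝ) (lam q : ℝ)
    (hf : ContDiff ℝ 2 f) (hf_bdd : BddBelow (Set.range f))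
    (hlam : 0 < lam) (hq0 : 0 < q) (hq1 : q < 1)
    (hLip : LocallyLipschitz (HpgSRN.hessian f))
    (hKL : HpgSRN.IsKLFunctionHalf (HpgSRN.objective f A lam q))
    (P : HpgSRN.Params) (heps : P.eps = 0)
    (x xbar : ℕ → EuclideanSpace ℝ (Fin n)) (mu mubar : ℕ → ℝ)
    (hrun : HpgSRN.IsInfiniteRun f A lam q P x xbar mu mubar) :
    ∃ Fstar : ℝ,
      HpgSRN.ConvergesQLinearly (fun k => HpgSRN.objective f A lam q (x k)) Fstar := by
  open HpgSRN in
  set F := objective f A lam q with hF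
  obtain ⟨C, hC, hstep⟩ := exists_step_decrease hf hf_bdd hlam hq0 hq1 hLip hrun (F (x 0))
  have hdec : ∀ k, F (x k) ≤ F (x 0) → F (x (k + 1)) ≤ F (x k) := by
    intro k hk
    have h1 : 0 ≤ C * (F (x k) - F (x (k + 1))) := by
      rcases hstep k hk with h | h <;> exact (sq_nonneg _).trans h
    exact sub_nonneg.1 (nonneg_of_mul_nonneg_right h1 hC)
  have hlevel : ∀ k, F (x k) ≤ F (x 0) := by
    intro k
    induction k with
    | zero => exact le_rfl
    | succ k ih => exact (hdec k ih).trans ih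
  have hanti : Antitone fun k => F (x k) := antitone_nat_of_succ_le fun k => hdec k (hlevel k)
  have hbdd : BddBelow (range fun k => F (x k)) := by
    obtain ⟨b, hb⟩ := hf_bdd
    refine ⟨b, ?_⟩
    rintro _ ⟨k, rfl⟩
    have h1 : b ≤ psi f A (x k) := hb ⟨_, rfl⟩
    exact h1.trans (le_add_of_nonneg_right (mul_nonneg hlam.le (lqPow_nonneg _)))
  obtain ⟨Fstar, hlim⟩ : ∃ Fstar, Tendsto (fun k => F (x k)) atTop (𝓝 Fstar) :=
    ⟨_, tendsto_atTop_ciInf hanti hbdd⟩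
  obtain ⟨R, hR⟩ := exists_norm_le_of_objective_le (n := n) (A := A) hf_bdd hlam hq0 (F (x 0))
  have hsub : ∀ z, critVec f A lam q z ∈ limitingSubdiff F z := fun z =>
    regularSubdiff_subset_limitingSubdiff _ _ (critVec_mem_regularSubdiff hf hlam hq0 hq1 z)
  obtain ⟨C', hC', K, hK⟩ := hKL.exists_uniform (continuous_objective hf hq0.le)
    (fun z => ⟨_, hsub z⟩) (fun k => hR _ (hlevel k)) hlim
  have hKL' : ∀ k ≥ K, F (x k) - Fstar ≤ C' * ‖critVec f A lam q (x k)‖ ^ 2 := by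
    intro k hk
    rcases (hanti.le_of_tendsto hlim k).eq_or_lt with h | h
    · have h1 : F (x k) - Fstar = 0 := sub_eq_zero.2 h.symm
      rw [h1]
      positivity
    · exact hK k hk h _ (hsub _)
  refine ⟨Fstar, convergesQLinearly_of_sub_le (C := C' * C) (K := K) hanti hlim (by positivity)
    fun k hk => ?_⟩
  rw [mul_assoc]
  rcases hstep k (hlevel k) with h | h
  · exact (hKL' (k + 1) (by omega)).trans (by gcongr)
  · exact (sub_le_sub_right (hanti (Nat.le_succ k)) _).trans
      ((hKL' k hk).trans (by gcongr))
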